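/- Let $\mathcal H_{\mathbb R}$ be a real Hilbert space. For each $N\ge 1$ let $\{X_N(f)\}_{f\in\mathcal H_{\mathbb R}}$ be a family of Hermitian Gaussian $N\times N$ random matrices: each $X_N(f)=(x_{ij}(f))_{i,j=1}^N$ is Hermitian, and the entries $\{x_{ij}(f) : 1\le i,j\le N,\ f\in\mathcal H_{\mathbb R}\}$ form a centred Gaussian family (their real and imaginary parts are jointly Gaussian) with $$\mathrm E\{x_{ij}(f)x_{kl}(g)\}=0\quad (i<j,\ k<l),\qquad \mathrm E\{x_{ij}(f)\overline{x_{kl}(g)}\}=\delta_{ik}\delta_{jl}\,\tfrac1N\langle f,g\rangle\quad (i\le j,\ k\le l).$$ Let $r\ge1$, $n(1),\dots,n(r)\ge1$, put $n=n(1)+\dots+n(r)$, and let $f_1,\dots,f_n\in\mathcal H_{\mathbb R}$. Write $\mathrm{Tr}$ for the unnormalized trace and $$Y^{(N)}_l=\mathrm{Tr}\bigl[X_N(f_{n(1)+\dots+n(l-1)+1})\cdots X_N(f_{n(1)+\dots+n(l)})\bigr]\qquad(1\le l\le r).$$ Let $\mathrm k_r$ be the $r$-th classical cumulant, $$\mathrm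 k_r\{Y_1,\dots,Y_r\}=\sum_{A}(-1)^{\#A-1}(\#A-1)!\prod_{B\in A}\mathrm E\Bigl\{\prod_{i\in B}Y_i\Bigr\},$$ where $A$ runs over the partitions of $\{1,\dots,r\}$. Let $\gamma$ be the permutation of $\{1,\dots,n\}$ with the $r$ cycles $(n(1)+\dots+n(l-1)+1,\dots,n(1)+\dots+n(l))$, $1\le l\le r$, and let $\#(\sigma)$ be the number of cycles of a permutation $\sigma$ (fixed points included). Let $NC_2(n(1),\dots,n(r))$ be the set of multi-annular non-crossing pairings, that is, of the pairings $\pi$ of $\{1,\dots,n\}$ which, viewed as permutations with all cycles of length two, are connected (the group generated by $\pi$ and $\gamma$ acts transitively on $\{1,\dots,n\}$) and planar ($\#(\pi)+\#(\gamma\pi^{-1})=n+2-r$). Then all products $\prod_{l\in B}Y^{(N)}_l$, $B\subseteq\{1,\dots,r\}$, are integrable, and as $N\to\infty$ $$\mathrm k_r\bigl\{Y^{(N)}_1,\dots,Y^{(N)}_r\bigr\}=N^{2-r}\sum_{\pi\in NC_2(n(1),\dots,n(r))}\ \prod_{\{i,j\}\in\pi}\langle f_i,f_j\rangle+O(N^{-r}).$$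 -/

import Mathlib

open MeasureTheory ProbabilityTheory Asymptotics Filter

/-- The joint classical cumulant `k_r{Y_1, …, Y_r}` of complex random variables: the sum over all
set partitions `A` of the index set of
`(-1) ^ (#A - 1) * (#A - 1)! * ∏_{B ∈ A} E[∏_{i ∈ B} Y_i]`. -/
noncomputable def jointCumulant {Ω : Type*} [MeasurableSpace Ω] (P : Measure Ω) {r : ℕ}
    (Y : Fin r → Ω → ℂ) : ℂ :=
  ∑ A : Finpartition (Finset.univ : Finset (Fin r)),
    (-1) ^ (A.parts.card - 1) * ((A.parts.card - 1).factorial : ℂ) *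
      ∏ B ∈ A.parts, ∫ ω, ∏ i ∈ B, Y i ω ∂P

/-- A family `{X(f)}`, indexed by a real inner product space, of `N × N` Hermitian Gaussian random
matrices: the matrices are Hermitian, and their entries form a centred (jointly) Gaussian family
with `E{x_ij(f) x_kl(g)} = 0` for `i < j`, `k < l`, and
`E{x_ij(f) conj x_kl(g)} = δ_ik δ_jl ⟨f, g⟩ / N` for `i ≤ j`, `k ≤ l`.
Gaussianity of the `ℂ`-valued process is over the real field, that is, the real and the imaginary
parts of all the entries are jointly Gaussian. -/
structure IsHermitianGaussianFamily {Ω : Type*} [MeasurableSpace Ω] (P : Measure Ω)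
    {H : Type*} [NormedAddCommGroup H] [InnerProductSpace ℝ H] {N : ℕ}
    (X : H → Ω → Matrix (Fin N) (Fin N) ℂ) : Prop where
  isHermitian : ∀ f, ∀ᵐ ω ∂P, (X f ω).IsHermitian
  isGaussian : IsGaussianProcess
    (fun (a : H × Fin N × Fin N) (ω : Ω) => X a.1 ω a.2.1 a.2.2) P
  centered : ∀ f i j, ∫ ω, X f ω i j ∂P = 0
  pseudoCovariance : ∀ f g i j k l, i < j → k < l → ∫ ω, X f ω i j * X g ω k l ∂P = 0
  covariance : ∀ f g i j k l, i ≤ j → k ≤ l →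
    ∫ ω, X f ω i j * star (X g ω k l) ∂P
      = if i = k ∧ j = l then (N : ℂ)⁻¹ * ((inner ℝ f g : ℝ) : ℂ) else 0

/-- The points of the multi-annulus: `r` circles, with `n i` points on the `i`-th circle. The pair
`⟨i, k⟩` stands for the number `n 0 + ⋯ + n (i - 1) + k` (everything being counted from `0`). -/
abbrev AnnulusPoint {r : ℕ} (n : Fin r → ℕ) : Type := Σ i : Fin r, Fin (n i)

/-- The permutation `γ` whose cycles are the `r` circles, each traversed once in order. -/
def annulusRotation {r : ℕ} (n : Fin r → ℕ) : Equiv.Perm (AnnulusPoint n) :=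
  Equiv.sigmaCongrRight fun i => finRotate (n i)

/-- The number `#(σ)` of cycles of a permutation, fixed points included. -/
noncomputable def numCycles {α : Type*} (σ : Equiv.Perm α) : ℕ :=
  Nat.card (Quotient (Equiv.Perm.SameCycle.setoid σ))

/-- Multi-annular non-crossing permutations `S_NC(n(1), …, n(r))`: `τ` connects the circles, i.e.
`τ` and `γ` together generate a transitive group, and `τ` is planar, i.e.
`#(τ) + #(γ τ⁻¹) = n(1) + ⋯ + n(r) + 2 - r`. -/
def IsNonCrossingPerm {r : ℕ} (n : Fin r → ℕ) (τ : Equiv.Perm (AnnulusPoint n)) : Prop :=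
  MulAction.IsPretransitive
      (Subgroup.closure ({τ, annulusRotation n} : Set (Equiv.Perm (AnnulusPoint n))))
      (AnnulusPoint n) ∧
    numCycles τ + numCycles (annulusRotation n * τ⁻¹) + r = (∑ i, n i) + 2

/-- A pairing, viewed as a permutation all of whose cycles have exactly two elements. -/
def IsPairing {α : Type*} (τ : Equiv.Perm α) : Prop :=
  ∀ x, τ x ≠ x ∧ τ (τ x) = x

open Classical in
/-- The multi-annular non-crossing pairings `NC₂(n(1), …, n(r))`. -/
noncomputable def nonCrossingPairings {r : ℕ} (n : Fin r → ℕ) :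
    Finset (Equiv.Perm (AnnulusPoint n)) :=
  Finset.univ.filter fun τ => IsPairing τ ∧ IsNonCrossingPerm n τ

open Classical in
/-- The product of `⟨f_i, f_j⟩` over all the (unordered) pairs `{i, j}` of the pairing `τ`, each
pair being taken once. -/
noncomputable def pairingWeight {α : Type*} [Fintype α] {H : Type*} [NormedAddCommGroup H]
    [InnerProductSpace ℝ H] (f : α → H) (τ : Equiv.Perm α) : ℝ :=
  ∏ p ∈ (Finset.univ : Finset α).image (fun x => s(x, τ x)),
    Sym2.lift ⟨fun i j => inner ℝ (f i) (f j), fun i j => real_inner_comm (f j) (f i)⟩ p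

/-- The random variable `Tr(X(f_1) X(f_2) ⋯ X(f_m))`, with the unnormalized trace. -/
noncomputable def traceProduct {Ω H : Type*} {N m : ℕ}
    (X : H → Ω → Matrix (Fin N) (Fin N) ℂ) (f : Fin m → H) (ω : Ω) : ℂ :=
  Matrix.trace (List.ofFn fun k => X (f k) ω).prod

/-! The proof is the genus expansion. Wick's formula turns a moment of traces into a sum over
pairings π. Each pair contributes a factor 1/N and identifies matrix indices, and the indices that
survive are the functions constant on the cycles of γπ. A pairing therefore has weight N^(#(γπ) -
#(π)) ∏⟨f_i, f_j⟩.

The cumulant keeps exactly the connected pairings. Colour the r traces with m colours and multiply,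
over the colours, the expectations of the products of traces of that colour. Summed over all
colourings, this is a combination of falling factorials of m with the products of block moments as
coefficients (`sum_prod_fiber_eq_sum_finpartition`). By Wick it is also a sum over pairings, where π
is counted once for each colouring constant on the orbits of ⟨γ, π⟩, hence m^(number of orbits)
times. The coefficient of m is the cumulant on one side and the sum over connected π on the other
(`sum_finpartition_cumulant_eq`). The result is exact for every N ≥ 1
(`jointCumulant_traceProduct`).

For connected π the genus inequality gives #(γ) + #(π) + #(γπ) ≤ n + 2, with even defect
(`numCycles_add_numCycles_add_numCycles_mul`). As 2#(π) = n and #(γ) = r, the exponent of N is 2 - r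
for planar π and at most -r otherwise.

Wick's formula compares two symmetric multilinear forms in the coefficient vectors. By polarization
only the diagonal matters, and there it is the moment formula for one Gaussian variable, (2k-1)!!
being the number of pairings of 2k points. -/

/-! ### Merging two classes of an equivalence relation -/

/-- The finest equivalence relation that contains `s` and identifies `a` with `b`. -/
def Setoid.merge {α : Type*} (s : Setoid α) (a b : α) : Setoid α :=
  s ⊔ Relation.EqvGen.setoid fun x y => x = a ∧ y = b

lemma Setoid.merge_le_iff {α : Type*} {s t : Setoid α} {a b : α} :
    s.merge a b ≤ t ↔ s ≤ t ∧ t a b := by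
  rw [Setoid.merge, sup_le_iff]
  refine and_congr_right fun _ => ⟨fun h => h (Relation.EqvGen.rel a b ⟨rfl, rfl⟩), fun h => ?_⟩
  exact Setoid.eqvGen_le fun x y hxy => by rw [hxy.1, hxy.2]; exact h

lemma Setoid.le_merge {α : Type*} (s : Setoid α) (a b : α) : s ≤ s.merge a b :=
  (Setoid.merge_le_iff.1 le_rfl).1

lemma Setoid.merge_rel {α : Type*} (s : Setoid α) (a b : α) : s.merge a b a b :=
  (Setoid.merge_le_iff.1 le_rfl).2

lemma Setoid.merge_eq_self {α : Type*} {s : Setoid α} {a b : α} (h : s a b) :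
    s.merge a b = s :=
  le_antisymm (Setoid.merge_le_iff.2 ⟨le_rfl, h⟩) (s.le_merge a b)

-- Redirecting the class of b to that of a presents the merged quotient as the range of a map, from
-- which only the class of b is missing when a and b are inequivalent.
open Classical in
lemma Setoid.merge_eq_ker {α : Type*} (s : Setoid α) (a b : α) :
    s.merge a b = Setoid.ker fun x : α =>
      if (Quotient.mk s x) = Quotient.mk s b then Quotient.mk s a else Quotient.mk s x := by
  apply le_antisymm
  · refine Setoid.merge_le_iff.2 ⟨fun x y hxy => ?_, ?_⟩
    · rw [Setoid.ker_def, Quotient.sound hxy]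
    · rw [Setoid.ker_def]; simp
  · intro x y hxy
    have hs : ∀ {u v : α}, Quotient.mk s u = Quotient.mk s v → s.merge a b u v :=
      fun h => s.le_merge a b (Quotient.exact h)
    have hab := s.merge_rel a b
    rw [Setoid.ker_def] at hxy
    split_ifs at hxy with h1 h2 h2
    · exact hs (h1.trans h2.symm)
    · exact Setoid.trans' _ (hs h1) (Setoid.trans' _ (Setoid.symm' _ hab) (hs hxy))
    · exact Setoid.trans' _ (hs hxy) (Setoid.trans' _ hab (Setoid.symm' _ (hs h2)))
    · exact hs hxy

lemma Setoid.card_quotient_merge {α : Type*} [Finite α] {s : Setoid α} {a b : α} (h : ¬ s a b) :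
    Nat.card (Quotient (s.merge a b)) + 1 = Nat.card (Quotient s) := by
  classical
  rw [Setoid.merge_eq_ker, Nat.card_congr (Setoid.quotientKerEquivRange _)]
  have hne : Quotient.mk s a ≠ Quotient.mk s b := fun h' => h (Quotient.exact h')
  have hr : Set.range (fun x : α =>
      if (Quotient.mk s x) = Quotient.mk s b then Quotient.mk s a else Quotient.mk s x)
      = {Quotient.mk s b}ᶜ := by
    ext q
    simp only [Set.mem_range, Set.mem_compl_iff, Set.mem_singleton_iff]
    constructor
    · rintro ⟨x, rfl⟩
      split_ifs with h1
      · exact hne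
      · exact h1
    · intro hq
      induction q using Quotient.inductionOn with
      | h x => exact ⟨x, if_neg hq⟩
  rw [hr, Nat.card_coe_set_eq, ← Set.ncard_singleton (Quotient.mk s b), add_comm,
    Set.ncard_add_ncard_compl]

/-! ### Cycles of a permutation and multiplication by a transposition -/

lemma sameCycle_setoid_le_iff {α : Type*} {σ : Equiv.Perm α} {s : Setoid α} :
    Equiv.Perm.SameCycle.setoid σ ≤ s ↔ ∀ x, s x (σ x) := by
  constructor
  · intro h x
    exact h (Equiv.Perm.sameCycle_apply_right.2 (Equiv.Perm.SameCycle.refl σ x))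
  · rintro h x _ ⟨k, rfl⟩
    induction k using Int.induction_on with
    | zero => simp
    | succ k ih =>
      rw [add_comm, zpow_add, zpow_one, Equiv.Perm.mul_apply]
      exact Setoid.trans' _ ih (h _)
    | pred k ih =>
      refine Setoid.trans' _ ih (Setoid.symm' _ ?_)
      have := h ((σ ^ (-(k : ℤ) - 1)) x)
      rwa [← Equiv.Perm.mul_apply, ← zpow_one_add, add_sub_cancel] at this

lemma sameCycle_setoid_apply {α : Type*} (σ : Equiv.Perm α) (x : α) :
    Equiv.Perm.SameCycle.setoid σ x (σ x) :=
  sameCycle_setoid_le_iff.1 le_rfl x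

section Swap

variable {α : Type*} [Finite α] [DecidableEq α] {σ : Equiv.Perm α} {a b : α}

/-- The new permutation sends a to σ b, then follows the σ-cycle of b, which never meets a, until it
returns to b. -/
lemma sameCycle_mul_swap_of_not_sameCycle (h : ¬ σ.SameCycle a b) :
    (σ * Equiv.swap a b).SameCycle a b := by
  have key : ∀ j : ℕ, (σ * Equiv.swap a b).SameCycle a ((σ ^ (j + 1)) b) := by
    intro j
    have h1 : (σ * Equiv.swap a b).SameCycle a (σ b) := by
      have := sameCycle_setoid_apply (σ * Equiv.swap a b) a
      rwa [Equiv.Perm.mul_apply, Equiv.swap_apply_left] at this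
    induction j with
    | zero => simpa using h1
    | succ j ih =>
      rw [pow_succ', Equiv.Perm.mul_apply]
      by_cases hb : (σ ^ (j + 1)) b = b
      · rwa [hb]
      · have ha : (σ ^ (j + 1)) b ≠ a := fun ha =>
          h (Equiv.Perm.SameCycle.symm ⟨(j + 1 : ℕ), by rw [zpow_natCast, ha]⟩)
        have := sameCycle_setoid_apply (σ * Equiv.swap a b) ((σ ^ (j + 1)) b)
        rw [Equiv.Perm.mul_apply, Equiv.swap_apply_of_ne_of_ne ha hb] at this
        exact ih.trans this
  have := key (orderOf σ - 1)
  rwa [Nat.sub_add_cancel (orderOf_pos σ), pow_orderOf_eq_one] at this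

/-- Let k > 0 be least with σ^k a = b. The new permutation sends b to σ a, so the orbit of b stays
in the arc σ a, …, σ^k a = b, which omits a by minimality of k. -/
lemma not_sameCycle_mul_swap_of_sameCycle (h : σ.SameCycle a b) (hab : a ≠ b) :
    ¬ (σ * Equiv.swap a b).SameCycle a b := by
  have hex : ∃ k : ℕ, 0 < k ∧ (σ ^ k) a = b := by
    obtain ⟨k, hk, -, hkb⟩ := h.exists_pow_eq''
    exact ⟨k, hk, hkb⟩
  obtain ⟨hk, hkb⟩ := Nat.find_spec hex
  have hmin : ∀ j, 0 < j → j < Nat.find hex → (σ ^ j) a ≠ b := fun j h0 hj hb =>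
    Nat.find_min hex hj ⟨h0, hb⟩
  set k := Nat.find hex
  have hT : ∀ m : ℕ, ∃ j, 0 < j ∧ j ≤ k ∧ ((σ * Equiv.swap a b) ^ m) b = (σ ^ j) a := by
    intro m
    induction m with
    | zero => exact ⟨k, hk, le_rfl, by simpa using hkb.symm⟩
    | succ m ih =>
      obtain ⟨j, hj0, hjk, hj⟩ := ih
      rw [pow_succ', Equiv.Perm.mul_apply, hj, Equiv.Perm.mul_apply]
      rcases hjk.lt_or_eq with hlt | rfl
      · have h1 : (σ ^ j) a ≠ b := hmin j hj0 hlt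
        have h2 : (σ ^ j) a ≠ a := by
          intro h2
          refine hmin (k - j) (by omega) (by omega) ?_
          rw [← hkb]
          conv_rhs => rw [← Nat.sub_add_cancel hlt.le, pow_add, Equiv.Perm.mul_apply, h2]
        exact ⟨j + 1, by omega, hlt, by
          rw [Equiv.swap_apply_of_ne_of_ne h2 h1, pow_succ', Equiv.Perm.mul_apply]⟩
      · exact ⟨1, one_pos, hk, by rw [hkb, Equiv.swap_apply_right, pow_one]⟩
  intro hc
  obtain ⟨m, -, hm⟩ := hc.symm.exists_pow_eq'
  obtain ⟨j, hj0, hjk, hj⟩ := hT m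
  rw [hm] at hj
  rcases hjk.lt_or_eq with hlt | rfl
  · refine hmin (k - j) (by omega) (by omega) ?_
    rw [← hkb]
    conv_rhs => rw [← Nat.sub_add_cancel hlt.le, pow_add, Equiv.Perm.mul_apply, ← hj]
  · exact hab (hj.trans hkb)

lemma sameCycle_setoid_mul_swap (h : ¬ σ.SameCycle a b) :
    Equiv.Perm.SameCycle.setoid (σ * Equiv.swap a b)
      = (Equiv.Perm.SameCycle.setoid σ).merge a b := by
  have hab := sameCycle_mul_swap_of_not_sameCycle h
  apply le_antisymm
  · refine sameCycle_setoid_le_iff.2 fun x => ?_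
    have hs : ∀ y, (Equiv.Perm.SameCycle.setoid σ).merge a b y (σ y) := fun y =>
      Setoid.le_merge _ a b (sameCycle_setoid_apply σ y)
    have hm := Setoid.merge_rel (Equiv.Perm.SameCycle.setoid σ) a b
    rw [Equiv.Perm.mul_apply]
    by_cases hxa : x = a
    · rw [hxa, Equiv.swap_apply_left]; exact Setoid.trans' _ hm (hs b)
    by_cases hxb : x = b
    · rw [hxb, Equiv.swap_apply_right]; exact Setoid.trans' _ (Setoid.symm' _ hm) (hs a)
    rw [Equiv.swap_apply_of_ne_of_ne hxa hxb]; exact hs x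
  · refine Setoid.merge_le_iff.2 ⟨sameCycle_setoid_le_iff.2 fun x => ?_, hab⟩
    have hs := sameCycle_setoid_apply (σ * Equiv.swap a b)
    by_cases hxa : x = a
    · have := hs b
      rw [Equiv.Perm.mul_apply, Equiv.swap_apply_right] at this
      rw [hxa]; exact hab.trans this
    by_cases hxb : x = b
    · have := hs a
      rw [Equiv.Perm.mul_apply, Equiv.swap_apply_left] at this
      rw [hxb]; exact hab.symm.trans this
    have := hs x
    rwa [Equiv.Perm.mul_apply, Equiv.swap_apply_of_ne_of_ne hxa hxb] at this

lemma numCycles_mul_swap_of_not_sameCycle (h : ¬ σ.SameCycle a b) :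
    numCycles (σ * Equiv.swap a b) + 1 = numCycles σ := by
  rw [numCycles, sameCycle_setoid_mul_swap h, Setoid.card_quotient_merge h, numCycles]

lemma numCycles_mul_swap_of_sameCycle (h : σ.SameCycle a b) (hab : a ≠ b) :
    numCycles σ + 1 = numCycles (σ * Equiv.swap a b) := by
  simpa [mul_assoc] using
    numCycles_mul_swap_of_not_sameCycle (not_sameCycle_mul_swap_of_sameCycle h hab)

end Swap

lemma numCycles_le_card {α : Type*} [Finite α] (σ : Equiv.Perm α) : numCycles σ ≤ Nat.card α :=
  Nat.card_le_card_of_surjective _ Quotient.mk_surjective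

lemma numCycles_one {α : Type*} : numCycles (1 : Equiv.Perm α) = Nat.card α := by
  have h : Equiv.Perm.SameCycle.setoid (1 : Equiv.Perm α) = ⊥ :=
    le_antisymm (sameCycle_setoid_le_iff.2 fun x => rfl) bot_le
  rw [numCycles, h]
  exact Nat.card_congr Setoid.quotientBotEquiv

/-! ### The genus inequality -/

/-- The number of common orbits of two permutations. -/
noncomputable def numOrbits {α : Type*} (σ τ : Equiv.Perm α) : ℕ :=
  Nat.card (Quotient (Equiv.Perm.SameCycle.setoid σ ⊔ Equiv.Perm.SameCycle.setoid τ))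

/-- The genus inequality, together with the parity of the genus. -/
theorem numCycles_add_numCycles_add_numCycles_mul {α : Type*} [Finite α] (σ τ : Equiv.Perm α) :
    numCycles σ + numCycles τ + numCycles (σ * τ) ≤ Nat.card α + 2 * numOrbits σ τ ∧
      Even (numCycles σ + numCycles τ + numCycles (σ * τ) + Nat.card α) := by
  classical
  induction hk : Nat.card α - numCycles τ using Nat.strong_induction_on generalizing τ with
  | _ k ih =>
  by_cases hτ : τ = 1
  · subst hτ
    have h : numOrbits σ 1 = numCycles σ := by
      rw [numOrbits, sup_eq_left.2 (sameCycle_setoid_le_iff.2 fun x => Setoid.refl' _ x), numCycles]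
    rw [h, mul_one, numCycles_one]
    exact ⟨by omega, ⟨numCycles σ + Nat.card α, by ring⟩⟩
  obtain ⟨a, ha⟩ : ∃ a, τ a ≠ a := by
    by_contra! h
    exact hτ (Equiv.ext h)
  set b := τ a
  have hab : a ≠ b := fun h => ha h.symm
  have hcyc : τ.SameCycle a b := sameCycle_setoid_apply τ a
  -- Splitting off a transposition inside a cycle of τ gives ρ with one more cycle, so the induction
  -- runs down to τ = 1.
  obtain ⟨ρ, hρ⟩ : ∃ ρ, ρ = τ * Equiv.swap a b := ⟨_, rfl⟩
  have hτρ : τ = ρ * Equiv.swap a b := by simp [hρ, mul_assoc]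
  have hn : ¬ ρ.SameCycle a b := hρ ▸ not_sameCycle_mul_swap_of_sameCycle hcyc hab
  have hc1 := numCycles_mul_swap_of_not_sameCycle hn
  rw [← hτρ] at hc1
  have hle := numCycles_le_card ρ
  obtain ⟨ih1, ih2⟩ := ih _ (by omega) ρ rfl
  have hJ : Equiv.Perm.SameCycle.setoid σ ⊔ Equiv.Perm.SameCycle.setoid τ
      = (Equiv.Perm.SameCycle.setoid σ ⊔ Equiv.Perm.SameCycle.setoid ρ).merge a b := by
    rw [hτρ, sameCycle_setoid_mul_swap hn, Setoid.merge, Setoid.merge, sup_assoc]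
  have hσρ : Equiv.Perm.SameCycle.setoid (σ * ρ)
      ≤ Equiv.Perm.SameCycle.setoid σ ⊔ Equiv.Perm.SameCycle.setoid ρ := by
    refine sameCycle_setoid_le_iff.2 fun x => ?_
    refine Setoid.trans' _ (y := ρ x) ?_ ?_
    · exact (le_sup_right : _ ≤ _ ⊔ Equiv.Perm.SameCycle.setoid ρ) (sameCycle_setoid_apply ρ x)
    · exact (le_sup_left : Equiv.Perm.SameCycle.setoid σ ≤ _) (sameCycle_setoid_apply σ (ρ x))
  have hστ : σ * τ = σ * ρ * Equiv.swap a b := by rw [hτρ, mul_assoc]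
  -- If a and b share a common orbit of σ and ρ, passing to τ keeps the orbits, lowers #(ρ) by one
  -- and changes #(σρ) by ±1. Otherwise they lie in distinct cycles of σρ, and the orbit count and
  -- both cycle counts each drop by one, so both sides drop by two.
  by_cases hJab : (Equiv.Perm.SameCycle.setoid σ ⊔ Equiv.Perm.SameCycle.setoid ρ) a b
  · have ho : numOrbits σ τ = numOrbits σ ρ := by
      rw [numOrbits, hJ, Setoid.merge_eq_self hJab, numOrbits]
    by_cases hp : (σ * ρ).SameCycle a b
    · have := numCycles_mul_swap_of_sameCycle hp hab
      rw [← hστ] at this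
      grind
    · have := numCycles_mul_swap_of_not_sameCycle hp
      rw [← hστ] at this
      grind
  · have ho : numOrbits σ τ + 1 = numOrbits σ ρ := by
      rw [numOrbits, hJ, Setoid.card_quotient_merge hJab, numOrbits]
    have hp : ¬ (σ * ρ).SameCycle a b := fun h => hJab (hσρ h)
    have := numCycles_mul_swap_of_not_sameCycle hp
    rw [← hστ] at this
    grind

/-! ### Counting invariant functions; transitivity as a single common orbit -/

section Counting

variable {α : Type*}

lemma card_le_ker {β : Type*} [Finite α] (s : Setoid α) :
    Nat.card {h : α → β // s ≤ Setoid.ker h} = Nat.card β ^ Nat.card (Quotient s) := by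
  rw [Nat.card_congr (Setoid.liftEquiv s), Nat.card_fun]

lemma card_invariant_functions {β : Type*} [Finite α] (σ : Equiv.Perm α) :
    Nat.card {h : α → β // ∀ x, h x = h (σ x)} = Nat.card β ^ numCycles σ := by
  rw [numCycles, ← card_le_ker]
  refine Nat.card_congr (Equiv.subtypeEquivRight fun h => ?_)
  rw [sameCycle_setoid_le_iff]
  rfl

lemma numOrbits_eq_one_iff [Finite α] [Nonempty α] (σ τ : Equiv.Perm α) :
    numOrbits σ τ = 1 ↔
      MulAction.IsPretransitive (Subgroup.closure ({τ, σ} : Set (Equiv.Perm α))) α := by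
  set J := Equiv.Perm.SameCycle.setoid σ ⊔ Equiv.Perm.SameCycle.setoid τ with hJ
  have hσ : ∀ x, J x (σ x) := sameCycle_setoid_le_iff.1 le_sup_left
  have hτ : ∀ x, J x (τ x) := sameCycle_setoid_le_iff.1 le_sup_right
  have hclosure : ∀ g ∈ Subgroup.closure ({τ, σ} : Set (Equiv.Perm α)), ∀ x, J x (g x) := by
    intro g hg
    induction hg using Subgroup.closure_induction with
    | mem g hg =>
      rcases hg with rfl | rfl
      · exact hτ
      · exact hσ
    | one => exact fun x => Setoid.refl' _ x
    | mul g h _ _ ihg ihh => exact fun x => Setoid.trans' _ (ihh x) (ihg _)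
    | inv g _ ih => exact fun x => Setoid.symm' _ (by simpa using ih (g⁻¹ x))
  constructor
  · intro h
    have hsub : Subsingleton (Quotient J) := by
      rw [numOrbits, Nat.card_eq_one_iff_unique] at h
      exact h.1
    have hle : J ≤ MulAction.orbitRel (Subgroup.closure ({τ, σ} : Set (Equiv.Perm α))) α := by
      refine sup_le ?_ ?_ <;> refine sameCycle_setoid_le_iff.2 fun x => Setoid.symm' _ ?_
      · exact ⟨⟨σ, Subgroup.subset_closure (by simp)⟩, rfl⟩
      · exact ⟨⟨τ, Subgroup.subset_closure (by simp)⟩, rfl⟩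
    exact ⟨fun x y => hle (Quotient.exact (Subsingleton.elim (Quotient.mk J y) (Quotient.mk J x)))⟩
  · intro h
    rw [numOrbits, Nat.card_eq_one_iff_unique]
    refine ⟨⟨fun p q => ?_⟩, Nonempty.map (Quotient.mk J) inferInstance⟩
    induction p, q using Quotient.inductionOn₂ with
    | h x y =>
      obtain ⟨g, rfl⟩ := h.exists_smul_eq x y
      exact Quotient.sound (hclosure g g.2 x)

end Counting

/-! ### The circles as cycles of γ -/

section Annulus

variable {r : ℕ} (n : Fin r → ℕ)

lemma finRotate_rel {m : ℕ} {s : Setoid (Fin m)} (h : ∀ x, s x (finRotate m x)) (x y : Fin m) :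
    s x y := by
  cases m with
  | zero => exact x.elim0
  | succ m =>
    have key : ∀ z : Fin (m + 1), s 0 z := by
      intro z
      induction z using Fin.induction with
      | zero => exact Setoid.refl' _ _
      | succ i ih =>
        refine Setoid.trans' _ ih ?_
        have := h i.castSucc
        rwa [finRotate_apply, Fin.coeSucc_eq_succ] at this
    exact Setoid.trans' _ (Setoid.symm' _ (key x)) (key y)

lemma sameCycle_setoid_annulusRotation :
    Equiv.Perm.SameCycle.setoid (annulusRotation n)
      = Setoid.ker (Sigma.fst : AnnulusPoint n → Fin r) := by
  apply le_antisymm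
  · exact sameCycle_setoid_le_iff.2 fun x => rfl
  · rintro ⟨l, k⟩ ⟨l', k'⟩ h
    obtain rfl : l = l' := h
    let f : Fin (n l) → AnnulusPoint n := fun k => ⟨l, k⟩
    exact finRotate_rel (s := (Equiv.Perm.SameCycle.setoid (annulusRotation n)).comap f)
      (fun x => sameCycle_setoid_apply (annulusRotation n) ⟨l, x⟩) k k'

variable {n}

lemma annulusPoint_fst_surjective (hn : ∀ i, 1 ≤ n i) :
    Function.Surjective (Sigma.fst : AnnulusPoint n → Fin r) :=
  fun l => ⟨⟨l, ⟨0, hn l⟩⟩, rfl⟩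

lemma numCycles_annulusRotation (hn : ∀ i, 1 ≤ n i) : numCycles (annulusRotation n) = r := by
  rw [numCycles, sameCycle_setoid_annulusRotation, Nat.card_congr
    (Setoid.quotientKerEquivOfSurjective _ (annulusPoint_fst_surjective hn)), Nat.card_fin]

/-- Since no circle is empty, colourings of the circles are the functions on points constant along
γ; invariance under τ makes them constant on the common orbits. -/
lemma card_invariant_circle_functions {β : Type*} (hn : ∀ i, 1 ≤ n i)
    (τ : Equiv.Perm (AnnulusPoint n)) :
    Nat.card {g : Fin r → β // ∀ x, g (τ x).1 = g x.1}
      = Nat.card β ^ numOrbits (annulusRotation n) τ := by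
  rw [numOrbits, ← card_le_ker]
  refine Nat.card_congr (Equiv.ofBijective (fun g => ⟨fun x => g.1 x.1, ?_⟩) ⟨?_, ?_⟩)
  · exact sup_le (sameCycle_setoid_le_iff.2 fun x => rfl)
      (sameCycle_setoid_le_iff.2 fun x => (g.2 x).symm)
  · intro g g' h
    refine Subtype.ext (funext fun l => ?_)
    exact congrFun (Subtype.ext_iff.1 h) ⟨l, ⟨0, hn l⟩⟩
  · rintro ⟨h, hh⟩
    have h1 : ∀ x y : AnnulusPoint n, x.1 = y.1 → h x = h y := by
      intro x y hxy
      have : Equiv.Perm.SameCycle.setoid (annulusRotation n) ≤ Setoid.ker h :=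
        le_sup_left.trans hh
      rw [sameCycle_setoid_annulusRotation] at this
      exact this hxy
    have h2 : ∀ x, h x = h (τ x) := sameCycle_setoid_le_iff.1 (le_sup_right.trans hh)
    refine ⟨⟨fun l => h ⟨l, ⟨0, hn l⟩⟩, fun x => ?_⟩, Subtype.ext (funext fun x => h1 _ _ rfl)⟩
    exact (h1 ⟨(τ x).1, ⟨0, hn _⟩⟩ (τ x) rfl).trans
      ((h2 x).symm.trans (h1 x ⟨x.1, ⟨0, hn _⟩⟩ rfl))

end Annulus

/-! ### Pairings and products over their pairs -/

section Pairing

variable {α : Type*} {τ : Equiv.Perm α}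

lemma IsPairing.inv_eq (h : IsPairing τ) : τ⁻¹ = τ := by
  refine inv_eq_of_mul_eq_one_left (Equiv.ext fun x => ?_)
  exact (h x).2

/-- Every pair has exactly one endpoint at which the label increases. -/
lemma IsPairing.numCycles_eq [Finite α] (h : IsPairing τ) {e : α → ℕ}
    (he : Function.Injective e) : numCycles τ = Nat.card {x // e x < e (τ x)} := by
  have hker : Equiv.Perm.SameCycle.setoid τ ≤ Setoid.ker fun x => s(x, τ x) :=
    sameCycle_setoid_le_iff.2 fun x => by
      rw [Setoid.ker_def, (h x).2]; exact Sym2.eq_swap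
  symm
  refine Nat.card_congr (Equiv.ofBijective
    (fun x => Quotient.mk (Equiv.Perm.SameCycle.setoid τ) x.1) ⟨?_, ?_⟩)
  · rintro ⟨x, hx⟩ ⟨y, hy⟩ hxy
    have := hker (Quotient.exact hxy)
    rw [Setoid.ker_def, Sym2.eq_iff] at this
    rcases this with ⟨h1, -⟩ | ⟨h1, h2⟩
    · exact Subtype.ext h1
    · dsimp only at h1
      rw [h1, (h y).2] at hx
      exact absurd hx hy.not_gt
  · intro q
    induction q using Quotient.inductionOn with
    | h x =>
      rcases lt_trichotomy (e x) (e (τ x)) with hlt | heq | hgt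
      · exact ⟨⟨x, hlt⟩, rfl⟩
      · exact absurd (he heq).symm (h x).1
      · exact ⟨⟨τ x, by rwa [(h x).2]⟩, Quotient.sound
          (Setoid.symm' _ (sameCycle_setoid_apply τ x))⟩

lemma IsPairing.two_mul_numCycles [Finite α] (h : IsPairing τ) :
    2 * numCycles τ = Nat.card α := by
  classical
  have := Fintype.ofFinite α
  have he : Function.Injective fun x => (Fintype.equivFin α x : ℕ) :=
    Fin.val_injective.comp (Fintype.equivFin α).injective
  set e := fun x => (Fintype.equivFin α x : ℕ)
  have h1 : Nat.card {x // e x < e (τ x)} = Nat.card {x // ¬ e x < e (τ x)} := by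
    refine Nat.card_congr (τ.subtypeEquiv fun x => ?_)
    rw [(h x).2, not_lt]
    exact ⟨le_of_lt, fun hle => hle.lt_of_ne fun heq => (h x).1 (he heq).symm⟩
  rw [two_mul]
  nth_rewrite 2 [h.numCycles_eq he]
  rw [h.numCycles_eq he, h1]
  nth_rewrite 2 [← h1]
  rw [Nat.card_eq_fintype_card, Nat.card_eq_fintype_card, Nat.card_eq_fintype_card, add_comm,
    Fintype.card_subtype_compl]
  exact Nat.add_sub_cancel' (Fintype.card_subtype_le _)

end Pairing

section PairProd

variable {α : Type*} [Fintype α]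

/-- The product of `q x (τ x)` over the pairs `{x, τ x}`, each oriented by the labelling `e`. -/
def pairProd {M : Type*} [CommMonoid M] (e : α → ℕ) (q : α → α → M) (τ : Equiv.Perm α) : M :=
  ∏ x with e x < e (τ x), q x (τ x)

open Classical in
/-- The pairings of a finite type. -/
noncomputable def pairings (α : Type*) [Fintype α] : Finset (Equiv.Perm α) :=
  Finset.univ.filter IsPairing

lemma mem_pairings {τ : Equiv.Perm α} : τ ∈ pairings α ↔ IsPairing τ := by
  classical
  simp [pairings]

lemma IsPairing.pairProd_eq_prod_image {M : Type*} [CommMonoid M] [DecidableEq α]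
    {τ : Equiv.Perm α} (h : IsPairing τ) {e : α → ℕ} (he : Function.Injective e)
    (q : α → α → M) (hq : ∀ x y, q x y = q y x) :
    pairProd e q τ
      = ∏ p ∈ (Finset.univ : Finset α).image (fun x => s(x, τ x)), Sym2.lift ⟨q, hq⟩ p := by
  have him : (Finset.univ : Finset α).image (fun x => s(x, τ x))
      = (Finset.univ.filter fun x => e x < e (τ x)).image (fun x => s(x, τ x)) := by
    apply subset_antisymm
    · intro p hp
      obtain ⟨x, -, rfl⟩ := Finset.mem_image.1 hp
      rcases lt_trichotomy (e x) (e (τ x)) with hlt | heq | hgt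
      · exact Finset.mem_image_of_mem _ (by simpa using hlt)
      · exact absurd (he heq).symm (h x).1
      · refine Finset.mem_image.2 ⟨τ x, by simpa [(h x).2] using hgt, ?_⟩
        rw [(h x).2]; exact Sym2.eq_swap
    · exact Finset.image_subset_image (Finset.subset_univ _)
  rw [him, Finset.prod_image, pairProd]
  · rfl
  · intro x hx y hy hxy
    simp only [Finset.coe_filter, Finset.mem_univ, true_and, Set.mem_ofPred_eq] at hx hy
    rcases Sym2.eq_iff.1 hxy with ⟨h1, -⟩ | ⟨h1, -⟩
    · exact h1
    · rw [h1, (h y).2] at hx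
      exact absurd hx hy.not_gt

/-- Conjugation by ρ may reverse the orientation of a pair, which the symmetry of q makes harmless.
-/
lemma pairProd_conj {M : Type*} [CommMonoid M] {e : α → ℕ} (he : Function.Injective e)
    {q : α → α → M} (hq : ∀ x y, q x y = q y x) {τ : Equiv.Perm α} (h : IsPairing τ)
    (ρ : Equiv.Perm α) :
    pairProd e (fun x y => q (ρ x) (ρ y)) τ = pairProd e q (ρ * τ * ρ⁻¹) := by
  classical
  have h' : IsPairing (ρ * τ * ρ⁻¹) := fun x => by
    have h1 := h (ρ.symm x)
    change ρ (τ (ρ.symm x)) ≠ x ∧ ρ (τ (ρ.symm (ρ (τ (ρ.symm x))))) = x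
    rw [Equiv.symm_apply_apply, h1.2, Equiv.apply_symm_apply]
    exact ⟨fun hx => h1.1 (ρ.eq_symm_apply.2 hx), rfl⟩
  rw [h'.pairProd_eq_prod_image he q hq,
    ← h'.pairProd_eq_prod_image (he.comp ρ⁻¹.injective) q hq, pairProd, pairProd]
  exact Finset.prod_equiv ρ (by simp) (by simp)

lemma sum_pairProd_comp {M : Type*} [CommSemiring M] {e : α → ℕ} (he : Function.Injective e)
    {q : α → α → M} (hq : ∀ x y, q x y = q y x) (ρ : Equiv.Perm α) :
    ∑ τ ∈ pairings α, pairProd e (fun x y => q (ρ x) (ρ y)) τ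
      = ∑ τ ∈ pairings α, pairProd e q τ := by
  refine Finset.sum_equiv (MulAut.conj ρ).toEquiv (fun τ => ?_) fun τ hτ => ?_
  · rw [mem_pairings, mem_pairings]
    change (∀ x, τ x ≠ x ∧ τ (τ x) = x) ↔
      ∀ x, ρ (τ (ρ.symm x)) ≠ x ∧ ρ (τ (ρ.symm (ρ (τ (ρ.symm x))))) = x
    rw [← ρ.forall_congr_right (q := fun x => ρ (τ (ρ.symm x)) ≠ x ∧ _)]
    simp
  · exact pairProd_conj he hq (mem_pairings.1 hτ) ρ

end PairProd

/-! ### Polarization and the multilinear form of a pairing -/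

section Multilinear

variable {α V : Type*} [AddCommGroup V] [Module ℂ V]

/-- A symmetric multilinear form which vanishes on the diagonal vanishes. -/
lemma multilinear_eq_zero_of_diagonal [Fintype α] (D : MultilinearMap ℂ (fun _ : α => V) ℂ)
    (hD : ∀ (ρ : Equiv.Perm α) (v : α → V), D (fun a => v (ρ a)) = D v) (v : α → V)
    (h0 : ∀ S : Finset α, D (fun _ => ∑ a ∈ S, v a) = 0) : D v = 0 := by
  classical
  -- Inclusion-exclusion over the values omitted by φ leaves the surjective φ. These are
  -- permutations, so by symmetry each contributes D v.
  have h1 : ∑ U : Finset α, ((-1 : ℤ) ^ U.card : ℂ) * D (fun _ => ∑ a ∈ Uᶜ, v a)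
      = ∑ φ : α → α, if Function.Surjective φ then D v else 0 := by
    have h2 : ∀ U : Finset α, D (fun _ => ∑ a ∈ Uᶜ, v a)
        = ∑ φ : α → α, if U ⊆ (Finset.univ.image φ)ᶜ then D (fun a => v (φ a)) else 0 := by
      intro U
      rw [D.map_sum_finset (fun _ a => v a) (fun _ => Uᶜ), ← Finset.sum_filter]
      refine Finset.sum_congr ?_ fun _ _ => rfl
      ext φ
      simp only [Fintype.mem_piFinset, Finset.mem_compl, Finset.mem_filter, Finset.mem_univ,
        true_and, Finset.subset_iff, Finset.mem_image, not_exists]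
      exact ⟨fun h x hx a ha => h a (ha ▸ hx), fun h a ha => h ha a rfl⟩
    simp_rw [h2, Finset.mul_sum]
    rw [Finset.sum_comm]
    refine Finset.sum_congr rfl fun φ _ => ?_
    simp_rw [mul_ite, mul_zero]
    rw [← Finset.sum_filter, ← Finset.sum_mul]
    have h3 : (Finset.univ.filter fun U : Finset α => U ⊆ (Finset.univ.image φ)ᶜ)
        = ((Finset.univ.image φ)ᶜ).powerset := by ext; simp
    have h4 := Finset.sum_powerset_neg_one_pow_card (x := (Finset.univ.image φ)ᶜ)
    rw [h3]
    have h5 : ∑ U ∈ ((Finset.univ.image φ)ᶜ).powerset, ((-1 : ℤ) ^ U.card : ℂ)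
        = if (Finset.univ.image φ)ᶜ = ∅ then 1 else 0 := by exact_mod_cast h4
    rw [h5]
    have h6 : (Finset.univ.image φ)ᶜ = ∅ ↔ Function.Surjective φ := by
      rw [Finset.compl_eq_empty_iff, Finset.eq_univ_iff_forall]; simp [Function.Surjective]
    rw [ite_mul, one_mul, zero_mul]
    simp only [h6]
    split_ifs with hφ
    · exact hD (Equiv.ofBijective φ ⟨Finite.injective_iff_surjective.2 hφ, hφ⟩) v
    · rfl
  simp_rw [h0, mul_zero, Finset.sum_const_zero] at h1
  rw [← Finset.sum_filter, Finset.sum_const, eq_comm, smul_eq_zero] at h1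
  refine h1.resolve_left (Finset.card_ne_zero_of_mem (a := id) ?_)
  simpa using Function.surjective_id

variable [Fintype α]

/-- The vector at a enters only the factor of its own pair; the label order decides whether it is
the first or the second argument of B. -/
lemma IsPairing.exists_pairProd_update [DecidableEq α] {τ : Equiv.Perm α} (h : IsPairing τ)
    {e : α → ℕ} (he : Function.Injective e) (B : V →ₗ[ℂ] V →ₗ[ℂ] ℂ) (v : α → V) (a : α) :
    ∃ ℓ : V →ₗ[ℂ] ℂ, ∀ w, pairProd e
      (fun x y => B (Function.update v a w x) (Function.update v a w y)) τ = ℓ w := by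
  have hrest : ∀ b, (b = a ∨ τ b = a) → e b < e (τ b) → ∀ w,
      pairProd e (fun x y => B (Function.update v a w x) (Function.update v a w y)) τ
        = B (Function.update v a w b) (Function.update v a w (τ b)) *
          ∏ x ∈ (Finset.univ.filter fun x => e x < e (τ x)).erase b, B (v x) (v (τ x)) := by
    intro b hb hlt w
    rw [pairProd, ← Finset.mul_prod_erase _ _ (by simpa using hlt : b ∈ _)]
    congr 1
    refine Finset.prod_congr rfl fun x hx => ?_
    obtain ⟨hxb, hx⟩ := Finset.mem_erase.1 hx
    have hlt' : e x < e (τ x) := by simpa using hx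
    have h1 : x ≠ a := by
      rintro rfl
      rcases hb with rfl | hb
      · exact hxb rfl
      · rw [← hb, (h b).2] at hlt'
        exact absurd hlt' hlt.not_gt
    have h2 : τ x ≠ a := by
      rintro rfl
      rcases hb with rfl | hb
      · rw [(h x).2] at hlt
        exact absurd hlt' hlt.not_gt
      · exact hxb (τ.injective hb).symm
    rw [Function.update_of_ne h1, Function.update_of_ne h2]
  rcases lt_trichotomy (e a) (e (τ a)) with hlt | heq | hgt
  · refine ⟨(∏ x ∈ (Finset.univ.filter fun x => e x < e (τ x)).erase a, B (v x) (v (τ x))) •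
      B.flip (v (τ a)), fun w => ?_⟩
    rw [hrest a (Or.inl rfl) hlt, Function.update_self, Function.update_of_ne (h a).1, mul_comm]
    rfl
  · exact absurd (he heq).symm (h a).1
  · refine ⟨(∏ x ∈ (Finset.univ.filter fun x => e x < e (τ x)).erase (τ a), B (v x) (v (τ x))) •
      B (v (τ a)), fun w => ?_⟩
    rw [hrest (τ a) (Or.inr (h a).2) (by rwa [(h a).2]), (h a).2, Function.update_self,
      Function.update_of_ne (h a).1, mul_comm]
    rfl

/-- The multilinear form `v ↦ ∏ B (v x) (v (τ x))`, the product being over the pairs of `τ`. -/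
def IsPairing.form {τ : Equiv.Perm α} (h : IsPairing τ) {e : α → ℕ} (he : Function.Injective e)
    (B : V →ₗ[ℂ] V →ₗ[ℂ] ℂ) : MultilinearMap ℂ (fun _ : α => V) ℂ where
  toFun v := pairProd e (fun x y => B (v x) (v y)) τ
  map_update_add' v a x y := by
    obtain ⟨ℓ, hℓ⟩ := h.exists_pairProd_update he B v a
    simp only [hℓ, map_add]
  map_update_smul' v a c x := by
    obtain ⟨ℓ, hℓ⟩ := h.exists_pairProd_update he B v a
    simp only [hℓ, map_smul]

end Multilinear

/-! ### The number of pairings -/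

section PairingCount

variable (α : Type*) [Fintype α]

lemma pairings_eq_empty_of_odd (h : Odd (Fintype.card α)) : pairings α = ∅ := by
  refine Finset.eq_empty_of_forall_notMem fun τ hτ => ?_
  have := (mem_pairings.1 hτ).two_mul_numCycles
  rw [Nat.card_eq_fintype_card] at this
  rw [← this] at h
  exact (Nat.not_odd_iff_even.2 (even_two_mul _)) h

/-- Pairings are the permutations of cycle type 2^k, a conjugacy class of size (2k)!/(2^k k!). -/
lemma card_pairings {k : ℕ} (h : Fintype.card α = 2 * k) :
    (pairings α).card = (2 * k - 1).doubleFactorial := by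
  classical
  have h1 : pairings α
      = Finset.univ.filter fun τ : Equiv.Perm α => τ.cycleType = Multiset.replicate k 2 := by
    ext τ
    rw [mem_pairings, Finset.mem_filter, and_iff_right (Finset.mem_univ _)]
    have hprime : Fact (Nat.Prime 2) := ⟨Nat.prime_two⟩
    constructor
    · intro hτ
      have h2 : τ ^ 2 = 1 := Equiv.ext fun x => by rw [pow_two]; exact (hτ x).2
      have h3 : τ.support = Finset.univ := by
        ext x; simpa using (hτ x).1
      have h4 := Equiv.Perm.pow_prime_eq_one_iff.1 h2
      have h5 := τ.sum_cycleType
      rw [Multiset.eq_replicate]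
      refine ⟨?_, h4⟩
      rw [Multiset.eq_replicate.2 ⟨rfl, h4⟩, Multiset.sum_replicate, h3, Finset.card_univ, h,
        smul_eq_mul, mul_comm] at h5
      omega
    · intro hτ x
      have h2 : τ ^ 2 = 1 := Equiv.Perm.pow_prime_eq_one_iff.2 fun c hc => by
        rw [hτ] at hc; exact Multiset.eq_of_mem_replicate hc
      have h3 := τ.sum_cycleType
      rw [hτ, Multiset.sum_replicate, smul_eq_mul, mul_comm, ← h, eq_comm,
        Finset.card_eq_iff_eq_univ] at h3
      refine ⟨Equiv.Perm.mem_support.1 (h3 ▸ Finset.mem_univ x), ?_⟩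
      rw [← Equiv.Perm.mul_apply, ← pow_two, h2, Equiv.Perm.one_apply]
  have h2 := Equiv.Perm.card_of_cycleType_mul_eq α (Multiset.replicate k 2)
  rw [← h1, h, if_pos ⟨by simp [mul_comm], fun a ha => (Multiset.eq_of_mem_replicate ha).ge⟩] at h2
  cases k with
  | zero => simpa using h2
  | succ k =>
    have h3 : (Multiset.replicate (k + 1) 2).toFinset = {2} := by
      rw [Multiset.toFinset_replicate, if_neg k.succ_ne_zero]
    rw [h3, Finset.prod_singleton, Multiset.count_replicate_self, Multiset.sum_replicate,
      Multiset.prod_replicate, smul_eq_mul, mul_comm (k + 1) 2, Nat.sub_self, Nat.factorial_zero,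
      one_mul] at h2
    have h4 := Nat.factorial_eq_mul_doubleFactorial (2 * k + 1)
    have h5 := Nat.doubleFactorial_two_mul (k + 1)
    rw [show 2 * k + 1 + 1 = 2 * (k + 1) by ring, h5] at h4
    rw [h4, mul_comm] at h2
    exact Nat.eq_of_mul_eq_mul_left (by positivity) h2

end PairingCount

/-! ### Moments of one Gaussian variable -/

section Moments

open Real in
lemma integral_pow_two_mul_gaussianReal (v : NNReal) (k : ℕ) :
    ∫ x, x ^ (2 * k) ∂gaussianReal 0 v = (2 * k - 1).doubleFactorial * (v : ℝ) ^ k := by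
  by_cases hv : v = 0
  · subst hv
    rw [gaussianReal_zero_var, integral_dirac]
    cases k <;> simp
  have hv' : (0 : ℝ) < v := NNReal.coe_pos.2 (pos_iff_ne_zero.2 hv)
  rw [integral_gaussianReal_eq_integral_smul hv]
  have h1 : ∀ x : ℝ, gaussianPDFReal 0 v x • x ^ (2 * k)
      = (√(2 * π * v))⁻¹ * (|x| ^ ((2 * k : ℕ) : ℝ) * exp (-(2 * v : ℝ)⁻¹ * |x| ^ (2 : ℝ))) := by
    intro x
    rw [gaussianPDFReal, smul_eq_mul, rpow_natCast, rpow_two, sq_abs, pow_mul, pow_mul, sq_abs,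
      sub_zero]
    rw [show -x ^ 2 / (2 * (v : ℝ)) = -(2 * v : ℝ)⁻¹ * x ^ 2 by field_simp]
    ring
  simp_rw [h1]
  rw [integral_const_mul,
    integral_comp_abs (f := fun x : ℝ => x ^ ((2 * k : ℕ) : ℝ) * exp (-(2 * v : ℝ)⁻¹ * x ^ (2 : ℝ))),
    integral_rpow_mul_exp_neg_mul_rpow two_pos
      (neg_one_lt_zero.trans_le (Nat.cast_nonneg (2 * k))) (by positivity)]
  have h2 : (((2 * k : ℕ) : ℝ) + 1) / 2 = k + 1 / 2 := by push_cast; ring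
  have h3 : -(((2 * k : ℕ) : ℝ) + 1) / 2 = -(k + 1 / 2) := by push_cast; ring
  rw [h2, h3, Gamma_nat_add_half, inv_rpow (by positivity), rpow_neg (by positivity), inv_inv,
    rpow_add (by positivity), rpow_natCast, ← sqrt_eq_rpow, mul_pow,
    show 2 * π * (v : ℝ) = π * (2 * v) by ring, sqrt_mul pi_pos.le]
  have : √π ≠ 0 := (sqrt_pos.2 pi_pos).ne'
  have : √(2 * (v : ℝ)) ≠ 0 := (sqrt_pos.2 (by positivity)).ne'
  field_simp

lemma integral_pow_odd_gaussianReal (v : NNReal) {m : ℕ} (hm : Odd m) :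
    ∫ x, x ^ m ∂gaussianReal 0 v = 0 := by
  have h := gaussianReal_map_neg (μ := 0) (v := v)
  rw [neg_zero] at h
  have h1 : ∫ x, x ^ m ∂gaussianReal 0 v = ∫ x, (-x) ^ m ∂gaussianReal 0 v := by
    conv_lhs => rw [← h]
    rw [integral_map (by fun_prop) (by fun_prop)]
  simp_rw [hm.neg_pow, integral_neg] at h1
  linarith

variable {Ω : Type*} [MeasurableSpace Ω] {P : Measure Ω}

/-- This is Wick's formula on the diagonal. In odd degree both sides vanish, so the rounding in the
exponent is immaterial. -/
lemma ProbabilityTheory.HasGaussianLaw.integral_pow_card {W : Ω → ℝ} (hW : HasGaussianLaw W P)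
    (h0 : ∫ ω, W ω ∂P = 0) (α : Type*) [Fintype α] :
    ∫ ω, W ω ^ Fintype.card α ∂P
      = (pairings α).card * (∫ ω, W ω * W ω ∂P) ^ (Fintype.card α / 2) := by
  have hmap := hW.map_eq_gaussianReal
  have hvar : Var[W; P] = ∫ ω, W ω * W ω ∂P := by
    rw [variance_of_integral_eq_zero hW.aemeasurable h0]
    simp_rw [pow_two]
  rw [h0] at hmap
  have h1 : ∀ m : ℕ, ∫ ω, W ω ^ m ∂P = ∫ x, x ^ m ∂gaussianReal 0 Var[W; P].toNNReal := by
    intro m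
    rw [← hmap, integral_map hW.aemeasurable (by fun_prop)]
  rcases Nat.even_or_odd' (Fintype.card α) with ⟨k, hk | hk⟩
  · rw [card_pairings α hk, hk, h1, integral_pow_two_mul_gaussianReal,
      Real.coe_toNNReal _ (variance_nonneg _ _), hvar, Nat.mul_div_cancel_left _ two_pos]
  · rw [pairings_eq_empty_of_odd α ⟨k, hk⟩, h1, integral_pow_odd_gaussianReal _ ⟨k, hk⟩]
    simp

end Moments

/-! ### Wick's formula -/

section Wick

variable {Ω : Type*} [MeasurableSpace Ω] {P : Measure Ω}

/-- Hölder's inequality with all exponents equal to the number of factors. -/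
lemma integrable_prod_of_memLp [IsProbabilityMeasure P] {ι : Type*} (s : Finset ι)
    {f : ι → Ω → ℂ} (hf : ∀ i ∈ s, ∀ p : ENNReal, p ≠ ⊤ → MemLp (f i) p P) :
    Integrable (fun ω => ∏ i ∈ s, f i ω) P := by
  rcases s.eq_empty_or_nonempty with rfl | hs
  · simp
  have hc : (s.card : ENNReal) ≠ 0 := by exact_mod_cast hs.card_pos.ne'
  have h := MemLp.prod' (s := s) (p := fun _ => (s.card : ENNReal))
    fun i hi => hf i hi _ (ENNReal.natCast_ne_top _)
  rw [Finset.sum_const, nsmul_eq_mul, ENNReal.mul_inv_cancel hc (ENNReal.natCast_ne_top _),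
    inv_one] at h
  exact memLp_one_iff_integrable.1 h

lemma ProbabilityTheory.IsGaussianProcess.integrable_prod {T : Type*} {Z : T → Ω → ℂ}
    (hZ : IsGaussianProcess Z P) {ι : Type*} (s : Finset ι) (φ : ι → T) :
    Integrable (fun ω => ∏ i ∈ s, Z (φ i) ω) P := by
  have := hZ.isProbabilityMeasure
  exact integrable_prod_of_memLp s fun i _ p hp => (hZ.hasGaussianLaw_eval (φ i)).memLp hp

lemma ProbabilityTheory.IsGaussianProcess.ofReal {J : Type*} {G : J → Ω → ℝ}
    (hG : IsGaussianProcess G P) :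
    IsGaussianProcess (fun j ω => (G j ω : ℂ)) P :=
  hG.comp_left fun _ => Complex.ofRealCLM

/-- Wick's formula for complex linear combinations of centred jointly Gaussian real variables. -/
theorem integral_prod_sum_eq_sum_pairings {J : Type*} [Fintype J] {G : J → Ω → ℝ}
    (hG : IsGaussianProcess G P)
    (h0 : ∀ j, ∫ ω, G j ω ∂P = 0) {α : Type*} [Fintype α] {e : α → ℕ}
    (he : Function.Injective e) (v : α → J → ℂ) :
    ∫ ω, ∏ a, ∑ j, v a j * (G j ω : ℂ) ∂P = ∑ τ ∈ pairings α,
      pairProd e (fun a b => ∫ ω, (∑ j, v a j * (G j ω : ℂ)) * ∑ j, v b j * (G j ω : ℂ) ∂P) τ := by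
  classical
  have hint : ∀ φ : α → J, Integrable (fun ω => ∏ a, (G (φ a) ω : ℂ)) P := fun φ =>
    hG.ofReal.integrable_prod Finset.univ φ
  have hint2 : ∀ j k, Integrable (fun ω => (G j ω : ℂ) * (G k ω : ℂ)) P := fun j k => by
    simpa using hG.ofReal.integrable_prod Finset.univ ![j, k]
  -- The covariance extended bilinearly, not sesquilinearly, so that the pairing side is complex
  -- multilinear.
  let B : (J → ℂ) →ₗ[ℂ] (J → ℂ) →ₗ[ℂ] ℂ := LinearMap.mk₂ ℂ
    (fun u w => ∑ j, ∑ k, u j * w k * ∫ ω, (G j ω : ℂ) * (G k ω : ℂ) ∂P)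
    (fun u u' w => by simp [add_mul, Finset.sum_add_distrib])
    (fun c u w => by simp [mul_assoc, Finset.mul_sum])
    (fun u w w' => by simp [mul_add, add_mul, Finset.sum_add_distrib])
    (fun c u w => by simp [mul_assoc, mul_left_comm, Finset.mul_sum])
  have hB : ∀ u w, B u w = ∫ ω, (∑ j, u j * (G j ω : ℂ)) * ∑ j, w j * (G j ω : ℂ) ∂P := by
    intro u w
    simp_rw [Finset.sum_mul_sum, mul_mul_mul_comm]
    rw [integral_finsetSum _ fun j _ => integrable_finsetSum _ fun k _ => (hint2 j k).const_mul _]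
    refine Finset.sum_congr rfl fun j _ => ?_
    rw [integral_finsetSum _ fun k _ => (hint2 j k).const_mul _]
    refine Finset.sum_congr rfl fun k _ => ?_
    rw [integral_const_mul]
  have hBsymm : ∀ u w, B u w = B w u := fun u w => by
    rw [hB, hB]; simp_rw [mul_comm]
  let M : MultilinearMap ℂ (fun _ : α => J → ℂ) ℂ :=
    ∑ φ : α → J, (∫ ω, ∏ a, (G (φ a) ω : ℂ) ∂P) •
      (MultilinearMap.mkPiAlgebra ℂ α ℂ).compLinearMap fun a => LinearMap.proj (φ a)
  have hM : ∀ v, M v = ∫ ω, ∏ a, ∑ j, v a j * (G j ω : ℂ) ∂P := by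
    intro v
    simp_rw [Finset.prod_univ_sum, Finset.prod_mul_distrib, Fintype.piFinset_univ]
    rw [integral_finsetSum _ fun φ _ => (hint φ).const_mul _]
    simp only [M, _root_.sum_apply, _root_.smul_apply,
      MultilinearMap.compLinearMap_apply, MultilinearMap.mkPiAlgebra_apply, LinearMap.proj_apply,
      smul_eq_mul]
    refine Finset.sum_congr rfl fun φ _ => ?_
    rw [integral_const_mul, mul_comm]
  let W : MultilinearMap ℂ (fun _ : α => J → ℂ) ℂ :=
    ∑ τ ∈ (pairings α).attach, (mem_pairings.1 τ.2).form he B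
  have hW : ∀ v, W v = ∑ τ ∈ pairings α, pairProd e (fun a b => B (v a) (v b)) τ := by
    intro v
    rw [_root_.sum_apply, ← Finset.sum_attach (pairings α)]
    rfl
  -- For real w the combination is a single real Gaussian variable.
  have hdiag : ∀ w : J → ℝ, (M - W) (fun _ j => (w j : ℂ)) = 0 := by
    intro w
    have hlaw : HasGaussianLaw (fun ω => ∑ j, w j * G j ω) P :=
      (hG.smul w).hasGaussianLaw_fun_sum (I := Finset.univ)
    have hmean : ∫ ω, ∑ j, w j * G j ω ∂P = 0 := by
      rw [integral_finsetSum _ fun j _ => ((hG.hasGaussianLaw_eval j).integrable).const_mul _]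
      simp [integral_const_mul, h0]
    have h1 := hlaw.integral_pow_card hmean α
    have hcast : ∀ ω, ∑ j, (w j : ℂ) * (G j ω : ℂ) = ((∑ j, w j * G j ω : ℝ) : ℂ) := by
      intro ω; push_cast; rfl
    rw [_root_.sub_apply, sub_eq_zero, hM, hW]
    simp_rw [hB, hcast, Finset.prod_const, Finset.card_univ, ← Complex.ofReal_mul,
      ← Complex.ofReal_pow, integral_complex_ofReal]
    rw [h1]
    have h2 : ∀ τ ∈ pairings α, ∀ c : ℂ, pairProd e (fun _ _ => c) τ = c ^ (Fintype.card α / 2) := by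
      intro τ hτ c
      have h3 := (mem_pairings.1 hτ).numCycles_eq he
      have h4 := (mem_pairings.1 hτ).two_mul_numCycles
      rw [Nat.card_eq_fintype_card] at h4
      rw [Nat.card_eq_fintype_card, Fintype.card_subtype] at h3
      rw [pairProd, Finset.prod_const, ← h3, ← h4, Nat.mul_div_cancel_left _ two_pos]
    rw [Finset.sum_congr rfl fun τ hτ => h2 τ hτ _, Finset.sum_const, nsmul_eq_mul]
    push_cast
    rfl
  have hsymm : ∀ (ρ : Equiv.Perm α) (v : α → J → ℂ), (M - W) (fun a => v (ρ a)) = (M - W) v := by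
    intro ρ v
    rw [_root_.sub_apply, _root_.sub_apply, hM, hM, hW, hW,
      sum_pairProd_comp he (fun a b => hBsymm (v a) (v b)) ρ]
    congr 2
    funext ω
    exact Equiv.prod_comp ρ fun a => ∑ j, v a j * (G j ω : ℂ)
  have hzero : M - W = 0 := by
    -- For basis vectors, polarization needs the diagonal only at sums of basis vectors; these have
    -- real coordinates, so `hdiag` suffices.
    refine Module.Basis.ext_multilinear (fun _ => Pi.basisFun ℂ J) fun φ => ?_
    rw [_root_.zero_apply]
    refine multilinear_eq_zero_of_diagonal _ hsymm _ fun S => ?_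
    convert hdiag (∑ a ∈ S, Pi.single (φ a) 1) using 2
    funext a j
    simp only [Pi.basisFun_apply, Finset.sum_apply, Complex.ofReal_sum]
    refine Finset.sum_congr rfl fun a _ => ?_
    by_cases h : j = φ a
    · subst h; simp
    · simp [h]
  rw [← hM, sub_eq_zero.1 hzero, hW]
  simp_rw [hB]

/-- Wick's formula: the expectation of a product of centred jointly Gaussian complex variables. -/
theorem integral_prod_eq_sum_pairings {α : Type*} [Fintype α] {Z : α → Ω → ℂ}
    (hZ : IsGaussianProcess Z P) (h0 : ∀ a, ∫ ω, Z a ω ∂P = 0) {e : α → ℕ}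
    (he : Function.Injective e) :
    ∫ ω, ∏ a, Z a ω ∂P
      = ∑ τ ∈ pairings α, pairProd e (fun a b => ∫ ω, Z a ω * Z b ω ∂P) τ := by
  classical
  let Λ : Bool → ℂ →L[ℝ] ℝ := fun c => if c then Complex.imCLM else Complex.reCLM
  have hG : IsGaussianProcess (fun (j : α × Bool) ω => Λ j.2 (Z j.1 ω)) P :=
    (hZ.comp_right Prod.fst).comp_left fun j => Λ j.2
  have hG0 : ∀ j : α × Bool, ∫ ω, Λ j.2 (Z j.1 ω) ∂P = 0 := fun j => by
    rw [ContinuousLinearMap.integral_comp_comm _ (hZ.hasGaussianLaw_eval j.1).integrable, h0,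
      map_zero]
  have hsum : ∀ a ω, ∑ j : α × Bool, (if a = j.1 then (if j.2 then Complex.I else 1) else 0) *
      (Λ j.2 (Z j.1 ω) : ℂ) = Z a ω := by
    intro a ω
    rw [Fintype.sum_prod_type, Finset.sum_eq_single a]
    · simp only [Fintype.sum_bool, Λ]
      simp [mul_comm Complex.I, add_comm]
    · intro b _ hb
      simp [hb.symm]
    · simp
  have h := integral_prod_sum_eq_sum_pairings hG hG0 he
    fun (a : α) (j : α × Bool) => if a = j.1 then (if j.2 then Complex.I else 1) else 0
  simp_rw [hsum] at h
  exact h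

end Wick

/-! ### Cumulants as linear coefficients of colouring polynomials -/

section Partitions

variable {ι : Type*} [Fintype ι] [DecidableEq ι]

/-- The block of `a` in a partition of a finite type. -/
def Finpartition.block (A : Finpartition (Finset.univ : Finset ι)) (a : ι) : A.parts :=
  ⟨A.part a, A.part_mem.2 (Finset.mem_univ a)⟩

lemma Finpartition.block_eq_iff (A : Finpartition (Finset.univ : Finset ι)) (a : ι) (B : A.parts) :
    A.block a = B ↔ a ∈ B.1 := by
  rw [Subtype.ext_iff]
  exact A.part_eq_iff_mem B.2

/-- A function on a finite type is the same as a partition together with an injective labelling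
of its blocks. -/
lemma bijective_embedding_comp_block (κ : Type*) :
    Function.Bijective fun (p : Σ A : Finpartition (Finset.univ : Finset ι), A.parts ↪ κ) (a : ι) =>
      p.2 (p.1.block a) := by
  classical
  constructor
  · rintro ⟨A, u⟩ ⟨A', u'⟩ h
    have hu : ∀ a, u (A.block a) = u' (A'.block a) := fun a => congrFun h a
    have hblock : ∀ a b, A.block a = A.block b ↔ A'.block a = A'.block b := fun a b => by
      rw [← u.injective.eq_iff, hu, hu, u'.injective.eq_iff]
    have hpart : ∀ a, A.part a = A'.part a := fun a => by
      ext b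
      change b ∈ (A.block a).1 ↔ b ∈ (A'.block a).1
      rw [← A.block_eq_iff, ← A'.block_eq_iff, hblock]
    have hsub : ∀ {A A' : Finpartition (Finset.univ : Finset ι)}, (∀ a, A.part a = A'.part a) →
        A.parts ⊆ A'.parts := by
      intro A A' hpart B hB
      obtain ⟨a, ha⟩ := A.nonempty_of_mem_parts hB
      rw [← A.part_eq_of_mem hB ha, hpart]
      exact A'.part_mem.2 (Finset.mem_univ a)
    obtain rfl : A = A' :=
      Finpartition.ext ((hsub hpart).antisymm (hsub fun a => (hpart a).symm))
    congr 1
    ext B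
    obtain ⟨a, ha⟩ := A.nonempty_of_mem_parts B.2
    rw [← (A.block_eq_iff a B).2 ha, hu]
  · intro g
    let A := Finpartition.ofSetoid (Setoid.ker g)
    have hA : ∀ a b, b ∈ A.part a ↔ g a = g b := fun a b =>
      Finpartition.mem_part_ofSetoid_iff_rel
    have hne : ∀ B : A.parts, ∃ a, a ∈ B.1 := fun B => A.nonempty_of_mem_parts B.2
    choose c hc using hne
    have hgc : ∀ a, g (c (A.block a)) = g a := fun a => ((hA a _).1 (hc (A.block a))).symm
    refine ⟨⟨A, ⟨fun B => g (c B), fun B B' h => ?_⟩⟩, funext hgc⟩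
    have hBB' : A.block (c B) = A.block (c B') := (A.block_eq_iff _ _).2 ((hA _ _).2 h.symm)
    exact ((A.block_eq_iff _ B).2 (hc B)).symm.trans
      (hBB'.trans ((A.block_eq_iff _ B').2 (hc B')))

/-- Summing a multiplicative function of the fibres over all the functions into `Fin m` gives a
linear combination of the falling factorials of `m`. -/
lemma sum_prod_fiber_eq_sum_finpartition {R : Type*} [CommSemiring R] (w : Finset ι → R)
    (hw : w ∅ = 1) (m : ℕ) :
    ∑ g : ι → Fin m, ∏ j, w (Finset.univ.filter fun a => g a = j)
      = ∑ A : Finpartition (Finset.univ : Finset ι),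
        (m.descFactorial A.parts.card : R) * ∏ B ∈ A.parts, w B := by
  classical
  rw [← (Equiv.ofBijective _ (bijective_embedding_comp_block (ι := ι) (Fin m))).sum_comp,
    Fintype.sum_sigma]
  refine Finset.sum_congr rfl fun A _ => ?_
  have h : ∀ u : A.parts ↪ Fin m,
      ∏ j, w (Finset.univ.filter fun a => u (A.block a) = j) = ∏ B ∈ A.parts, w B := by
    intro u
    rw [← Finset.prod_coe_sort A.parts]
    symm
    refine Fintype.prod_of_injective u u.injective _ _ (fun j hj => ?_) fun B => ?_
    · rw [Finset.filter_eq_empty_iff.2, hw]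
      exact fun a _ ha => hj ⟨_, ha⟩
    · congr 1
      ext a
      simp [A.block_eq_iff]
  simp only [Equiv.ofBijective_apply, h, Finset.sum_const, Finset.card_univ, nsmul_eq_mul]
  rw [Fintype.card_embedding_eq, Fintype.card_fin, Fintype.card_coe]

/-- The source of the cumulant weights: X(X-1)⋯(X-k) has linear coefficient (-1)(-2)⋯(-k). -/
lemma coeff_one_descPochhammer_succ (k : ℕ) :
    (descPochhammer ℂ (k + 1)).coeff 1 = (-1) ^ k * (k.factorial : ℂ) := by
  rw [descPochhammer_succ_left, Polynomial.coeff_X_mul, Polynomial.coeff_zero_eq_eval_zero,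
    Polynomial.eval_comp, descPochhammer_eval_eq_prod_range]
  have h : ∀ j ∈ Finset.range k, Polynomial.eval 0 (Polynomial.X - 1 : Polynomial ℂ) - (j : ℂ)
      = (-1) * ((j + 1 : ℕ) : ℂ) := by
    intro j _
    simp; ring
  rw [Finset.prod_congr rfl h, Finset.prod_mul_distrib, Finset.prod_const, Finset.card_range,
    ← Nat.cast_prod, Finset.prod_range_add_one_eq_factorial]

/-- If a multiplicative function of the fibres, summed over all the functions into `Fin m`, is
polynomial in `m`, then its cumulant is the linear coefficient of this polynomial. -/
lemma sum_finpartition_cumulant_eq [Nonempty ι] (w : Finset ι → ℂ) (hw : w ∅ = 1) {T : Type*}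
    (s : Finset T) (c : T → ℂ) (d : T → ℕ)
    (h : ∀ m : ℕ, ∑ g : ι → Fin m, ∏ j, w (Finset.univ.filter fun a => g a = j)
      = ∑ τ ∈ s, c τ * (m : ℂ) ^ d τ) :
    ∑ A : Finpartition (Finset.univ : Finset ι),
        (-1) ^ (A.parts.card - 1) * ((A.parts.card - 1).factorial : ℂ) * ∏ B ∈ A.parts, w B
      = ∑ τ ∈ s.filter fun τ => d τ = 1, c τ := by
  let p : Polynomial ℂ := ∑ A : Finpartition (Finset.univ : Finset ι),
    Polynomial.C (∏ B ∈ A.parts, w B) * descPochhammer ℂ A.parts.card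
  let q : Polynomial ℂ := ∑ τ ∈ s, Polynomial.C (c τ) * Polynomial.X ^ d τ
  -- The two polynomials agree at every natural number m.
  have hpq : p = q := by
    refine Polynomial.eq_of_infinite_eval_eq _ _
      ((Set.infinite_range_of_injective Nat.cast_injective).mono ?_)
    rintro _ ⟨m, rfl⟩
    have := h m
    rw [sum_prod_fiber_eq_sum_finpartition w hw] at this
    simp only [p, q, Set.mem_ofPred_eq, Polynomial.eval_finsetSum, Polynomial.eval_mul,
      Polynomial.eval_C, Polynomial.eval_pow, Polynomial.eval_X,
      descPochhammer_eval_eq_descFactorial]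
    rw [← this]
    exact Finset.sum_congr rfl fun A _ => mul_comm _ _
  have hp : p.coeff 1 = ∑ A : Finpartition (Finset.univ : Finset ι),
      (-1) ^ (A.parts.card - 1) * ((A.parts.card - 1).factorial : ℂ) * ∏ B ∈ A.parts, w B := by
    simp only [p, Polynomial.finsetSum_coeff, Polynomial.coeff_C_mul]
    refine Finset.sum_congr rfl fun A _ => ?_
    have hA : 0 < A.parts.card := by
      obtain ⟨a⟩ := ‹Nonempty ι›
      exact Finset.card_pos.2 ⟨_, (A.block a).2⟩
    obtain ⟨k, hk⟩ := Nat.exists_eq_succ_of_ne_zero hA.ne'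
    rw [hk, Nat.succ_eq_add_one, coeff_one_descPochhammer_succ, Nat.add_sub_cancel, mul_comm]
  rw [← hp, hpq, Finset.sum_filter]
  simp only [q, Polynomial.finsetSum_coeff, Polynomial.coeff_C_mul, Polynomial.coeff_X_pow]
  exact Finset.sum_congr rfl fun τ _ => by simp [eq_comm]

end Partitions

/-! ### Splitting pairings and index sums along the fibres of a colouring -/

section Fibers

variable {α κ : Type*}

/-- The permutation obtained by permuting each of the fibres of a function. -/
def permOfFibers (φ : α → κ) (p : ∀ j, Equiv.Perm {x // φ x = j}) : Equiv.Perm α :=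
  (Equiv.sigmaFiberEquiv φ).permCongr (Equiv.sigmaCongrRight p)

lemma permOfFibers_apply (φ : α → κ) (p : ∀ j, Equiv.Perm {x // φ x = j}) {j : κ}
    (x : {x // φ x = j}) : permOfFibers φ p x = p j x := by
  obtain ⟨x, rfl⟩ := x
  rfl

lemma pairProd_permOfFibers [Fintype α] [Fintype κ] [DecidableEq κ] {M : Type*} [CommMonoid M]
    (φ : α → κ) (p : ∀ j, Equiv.Perm {x // φ x = j}) (e : α → ℕ) (q : α → α → M) :
    pairProd e q (permOfFibers φ p)
      = ∏ j, pairProd (fun x : {x // φ x = j} => e x) (fun x y => q x y) (p j) := by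
  simp_rw [pairProd, Finset.prod_filter]
  rw [← (Equiv.sigmaFiberEquiv φ).prod_comp, Fintype.prod_sigma]
  refine Finset.prod_congr rfl fun j _ => Finset.prod_congr rfl fun x _ => ?_
  simp only [Equiv.sigmaFiberEquiv, Equiv.coe_fn_mk, permOfFibers_apply]

/-- A pairing that preserves φ is the same as one pairing on each fibre. -/
lemma prod_sum_pairings_fiber [Fintype α] [Fintype κ] [DecidableEq κ] {M : Type*} [CommSemiring M]
    (φ : α → κ) [DecidablePred fun τ : Equiv.Perm α => ∀ x, φ (τ x) = φ x]
    (e : α → ℕ) (q : α → α → M) :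
    ∏ j, ∑ τ ∈ pairings {x // φ x = j},
        pairProd (fun x : {x // φ x = j} => e x) (fun x y => q x y) τ
      = ∑ τ ∈ (pairings α).filter (fun τ => ∀ x, φ (τ x) = φ x), pairProd e q τ := by
  rw [Finset.prod_univ_sum]
  refine Finset.sum_bij (fun p _ => permOfFibers φ p) ?_ ?_ ?_ ?_
  · intro p hp
    rw [Fintype.mem_piFinset] at hp
    rw [Finset.mem_filter, mem_pairings]
    have h1 : ∀ x, permOfFibers φ p x = p (φ x) ⟨x, rfl⟩ := fun x =>
      permOfFibers_apply φ p ⟨x, rfl⟩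
    refine ⟨fun x => ?_, fun x => ?_⟩
    · have h2 := mem_pairings.1 (hp (φ x)) ⟨x, rfl⟩
      rw [h1, permOfFibers_apply, h2.2]
      exact ⟨fun h => h2.1 (Subtype.ext h), rfl⟩
    · rw [h1]; exact (p (φ x) ⟨x, rfl⟩).2
  · intro p _ p' _ h
    funext j
    ext x
    rw [← permOfFibers_apply, ← permOfFibers_apply, h]
  · intro τ hτ
    rw [Finset.mem_filter, mem_pairings] at hτ
    have hφ : ∀ j x, φ (τ x) = j ↔ φ x = j := fun j x => by rw [hτ.2]
    refine ⟨fun j => τ.subtypePerm (hφ j), Fintype.mem_piFinset.2 fun j => mem_pairings.2 ?_, ?_⟩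
    · exact fun x => ⟨fun h => (hτ.1 x).1 (Subtype.ext_iff.1 h), Subtype.ext (hτ.1 x).2⟩
    · ext x
      exact permOfFibers_apply φ _ ⟨x, rfl⟩
  · intro p _
    exact (pairProd_permOfFibers φ p e q).symm

/-- A dependent function is the same as a family of dependent functions on the fibres. -/
def piFibersEquiv (g : α → κ) (β : α → Type*) :
    (∀ a, β a) ≃ ∀ j, ∀ a : {a // g a = j}, β a where
  toFun i j a := i a
  invFun h a := h (g a) ⟨a, rfl⟩
  left_inv _ := rfl
  right_inv h := by
    funext j ⟨a, ha⟩
    subst ha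
    rfl

lemma prod_integral_prod_sum [Fintype α] [Fintype κ] [DecidableEq κ] [DecidableEq α] {Ω : Type*}
    [MeasurableSpace Ω]
    {P : Measure Ω} (g : α → κ) {β : α → Type*} [∀ a, Fintype (β a)] (T : ∀ a, β a → Ω → ℂ)
    (hT : ∀ (S : Finset α) (i : ∀ a, β a), Integrable (fun ω => ∏ a ∈ S, T a (i a) ω) P) :
    ∏ j, ∫ ω, ∏ a with g a = j, ∑ b, T a b ω ∂P
      = ∑ i : ∀ a, β a, ∏ j, ∫ ω, ∏ a with g a = j, T a (i a) ω ∂P := by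
  -- With an empty `β a` both sides vanish; otherwise a choice on one fibre extends by default
  -- values to all of α, as `hT` requires.
  by_cases hβ : ∀ a, Nonempty (β a)
  swap
  · obtain ⟨a, ha⟩ := not_forall.1 hβ
    rw [not_nonempty_iff] at ha
    have : IsEmpty (∀ a, β a) := ⟨fun i => ha.elim (i a)⟩
    rw [Fintype.sum_empty]
    refine Finset.prod_eq_zero (Finset.mem_univ (g a)) ?_
    refine integral_eq_zero_of_ae (Eventually.of_forall fun ω => ?_)
    exact Finset.prod_eq_zero (i := a) (by simp) (Fintype.sum_empty _)
  have hsub : ∀ (j : κ) (F : α → ℂ), ∏ a with g a = j, F a = ∏ a : {a // g a = j}, F a :=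
    fun j F => Finset.prod_subtype _ (by simp) F
  have hint : ∀ j (h : ∀ a : {a // g a = j}, β a),
      Integrable (fun ω => ∏ a, T a.1 (h a) ω) P := by
    intro j h
    have := hT (Finset.univ.filter fun a => g a = j)
      fun a => if ha : g a = j then h ⟨a, ha⟩ else (hβ a).some
    simp_rw [Finset.prod_subtype (Finset.univ.filter fun a => g a = j) (p := fun a => g a = j)
      (by simp)] at this
    convert! this using 5 with ω a
    rw [dif_pos a.2]
  calc ∏ j, ∫ ω, ∏ a with g a = j, ∑ b, T a b ω ∂P
      = ∏ j, ∑ h : (∀ a : {a // g a = j}, β a), ∫ ω, ∏ a, T a.1 (h a) ω ∂P := by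
        refine Finset.prod_congr rfl fun j _ => ?_
        simp_rw [hsub]
        rw [← integral_finsetSum _ fun h _ => hint j h]
        simp_rw [Finset.prod_univ_sum, Fintype.piFinset_univ]
    _ = ∑ i : ∀ a, β a, ∏ j, ∫ ω, ∏ a with g a = j, T a (i a) ω ∂P := by
        rw [Finset.prod_univ_sum, Fintype.piFinset_univ]
        refine (Fintype.sum_equiv (piFibersEquiv g β) _ _ fun i => ?_).symm
        simp_rw [hsub]
        rfl

end Fibers

/-! ### Entries and traces of matrix products -/

section Trace

variable {R : Type*} [CommSemiring R] {ν : Type*} [Fintype ν] [DecidableEq ν]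

/-- Here i lists the interior indices of the path from a to b: prepending a gives the row indices,
appending b the column indices. -/
lemma list_ofFn_prod_apply {m : ℕ} (M : Fin (m + 1) → Matrix ν ν R) (a b : ν) :
    (List.ofFn M).prod a b = ∑ i : Fin m → ν, ∏ k,
      M k (Fin.cons (α := fun _ => ν) a i k) (Fin.snoc (α := fun _ => ν) i b k) := by
  induction m generalizing a with
  | zero =>
    simp [List.ofFn_succ, Fin.snoc]
  | succ m ih =>
    rw [List.ofFn_succ, List.prod_cons, Matrix.mul_apply]
    simp_rw [ih, Finset.mul_sum]
    rw [← Fintype.sum_prod_type' (f := fun (c : ν) (i : Fin m → ν) => M 0 a c * ∏ k : Fin (m + 1),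
      M k.succ (Fin.cons (α := fun _ => ν) c i k) (Fin.snoc (α := fun _ => ν) i b k))]
    refine Fintype.sum_equiv (Fin.consEquiv fun _ => ν) _ _ fun ⟨c, i⟩ => ?_
    change M 0 a c * _ = ∏ k, M k (Fin.cons (α := fun _ => ν) a (Fin.cons (α := fun _ => ν) c i) k)
      (Fin.snoc (α := fun _ => ν) (Fin.cons (α := fun _ => ν) c i) b k)
    conv_rhs => rw [Fin.prod_univ_succ, ← Fin.cons_snoc_eq_snoc_cons]
    rfl

/-- Closing the path makes the next index cyclic. The case m = 0 is excluded: the trace of the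
identity is the size of ν, while the sum is 1. -/
lemma trace_list_ofFn_prod {m : ℕ} (hm : 1 ≤ m) (M : Fin m → Matrix ν ν R) :
    Matrix.trace (List.ofFn M).prod
      = ∑ i : Fin m → ν, ∏ k, M k (i k) (i (finRotate m k)) := by
  obtain ⟨m, rfl⟩ := Nat.exists_eq_add_of_le' hm
  simp_rw [Matrix.trace, Matrix.diag_apply, list_ofFn_prod_apply]
  rw [← Fintype.sum_prod_type' (f := fun (a : ν) (i : Fin m → ν) => ∏ k : Fin (m + 1),
      M k (Fin.cons (α := fun _ => ν) a i k) (Fin.snoc (α := fun _ => ν) i a k))]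
  refine Fintype.sum_equiv (Fin.consEquiv fun _ => ν) _ _ fun ⟨a, i⟩ => ?_
  refine Finset.prod_congr rfl fun k _ => ?_
  congr 1
  cases k using Fin.lastCases with
  | last => simp
  | cast k => simp [finRotate_apply]

end Trace

/-! ### The genus expansion of the cumulants -/

section GaussianMatrices

variable {Ω : Type*} [MeasurableSpace Ω] {P : Measure Ω} {H : Type*} [NormedAddCommGroup H]
  [InnerProductSpace ℝ H] {N : ℕ} {X : H → Ω → Matrix (Fin N) (Fin N) ℂ}

/-- The hypotheses cover only entries on or above the diagonal; Hermitian symmetry, which exchanges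
transposition and conjugation, reduces all other positions to these. -/
lemma IsHermitianGaussianFamily.integral_mul (hX : IsHermitianGaussianFamily P X) (f g : H)
    (i j k l : Fin N) :
    ∫ ω, X f ω i j * X g ω k l ∂P
      = if i = l ∧ j = k then (N : ℂ)⁻¹ * ((inner ℝ f g : ℝ) : ℂ) else 0 := by
  have hs : ∀ f i j, ∀ᵐ ω ∂P, star (X f ω j i) = X f ω i j := fun f i j => by
    filter_upwards [hX.isHermitian f] with ω hω
    exact hω.apply i j
  have hswap : ∫ ω, X f ω i j * X g ω k l ∂P = ∫ ω, X g ω k l * X f ω i j ∂P := by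
    simp_rw [mul_comm]
  rcases le_or_gt i j with hij | hij
  · rcases le_or_gt l k with hlk | hlk
    · rw [← hX.covariance f g i j l k hij hlk]
      refine integral_congr_ae ?_
      filter_upwards [hs g k l] with ω hω
      rw [hω]
    · rcases hij.lt_or_eq with hij | rfl
      · rw [hX.pseudoCovariance f g i j k l hij hlk, if_neg]
        rintro ⟨rfl, rfl⟩
        exact absurd hij hlk.not_gt
      · rw [hswap]
        have h := hX.covariance g f k l i i hlk.le le_rfl
        rw [if_neg (by rintro ⟨rfl, rfl⟩; exact lt_irrefl _ hlk)] at h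
        rw [if_neg (by rintro ⟨rfl, rfl⟩; exact lt_irrefl _ hlk), ← h]
        refine integral_congr_ae ?_
        filter_upwards [hs f i i] with ω hω
        rw [hω]
  · rcases le_or_gt k l with hkl | hkl
    · have h := hX.covariance g f k l j i hkl hij.le
      rw [hswap]
      have hc : (i = l ∧ j = k) ↔ (k = j ∧ l = i) := by grind
      rw [real_inner_comm] at h
      simp only [hc]
      rw [← h]
      refine integral_congr_ae ?_
      filter_upwards [hs f i j] with ω hω
      rw [hω]
    · have h := hX.pseudoCovariance f g j i l k hij hkl
      rw [if_neg (by rintro ⟨rfl, rfl⟩; exact absurd hij hkl.not_gt)]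
      rw [← map_zero (starRingEnd ℂ), ← h, ← integral_conj]
      refine integral_congr_ae ?_
      filter_upwards [hs f i j, hs g k l] with ω h1 h2
      rw [map_mul, ← h1, ← h2]
      rfl

lemma traceProduct_eq_sum {Ω H : Type*} {N : ℕ} {X : H → Ω → Matrix (Fin N) (Fin N) ℂ}
    {m : ℕ} (hm : 1 ≤ m) (f : Fin m → H) (ω : Ω) :
    traceProduct X f ω
      = ∑ i : Fin m → Fin N, ∏ k, X (f k) ω (i k) (i (finRotate m k)) :=
  trace_list_ofFn_prod hm fun k => X (f k) ω

variable {r : ℕ} {n : Fin r → ℕ}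

lemma IsHermitianGaussianFamily.integrable_prod_traceProduct (hX : IsHermitianGaussianFamily P X)
    (hn : ∀ i, 1 ≤ n i) (f : AnnulusPoint n → H) (B : Finset (Fin r)) :
    Integrable (fun ω => ∏ i ∈ B, traceProduct X (fun k => f ⟨i, k⟩) ω) P := by
  simp_rw [traceProduct_eq_sum (hn _), Finset.prod_sum]
  refine integrable_finsetSum _ fun p _ => ?_
  have := hX.isGaussian.integrable_prod (B.attach.sigma fun l => (Finset.univ : Finset (Fin (n l))))
    fun x => (f ⟨x.1, x.2⟩, p x.1.1 x.1.2 x.2, p x.1.1 x.1.2 (finRotate _ x.2))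
  simpa only [Finset.prod_sigma] using this

/-- The sum over all the indices of the Wick contraction of a pairing. -/
lemma sum_pairProd_contraction {e : AnnulusPoint n → ℕ} (he : Function.Injective e)
    (f : AnnulusPoint n → H) {τ : Equiv.Perm (AnnulusPoint n)} (hτ : IsPairing τ) (N : ℕ) :
    ∑ i : AnnulusPoint n → Fin N, pairProd e (fun x y =>
        if i x = i (annulusRotation n y) ∧ i (annulusRotation n x) = i y
        then (N : ℂ)⁻¹ * ((inner ℝ (f x) (f y) : ℝ) : ℂ) else 0) τ
      = (N : ℂ)⁻¹ ^ numCycles τ * (N : ℂ) ^ numCycles (annulusRotation n * τ) *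
          (pairingWeight f τ : ℂ) := by
  classical
  have hcard : (Finset.univ.filter fun x => e x < e (τ x)).card = numCycles τ := by
    rw [hτ.numCycles_eq he, Nat.card_eq_fintype_card, Fintype.card_subtype]
  have hw : ∏ x with e x < e (τ x), (inner ℝ (f x) (f (τ x)) : ℝ) = pairingWeight f τ := by
    have := hτ.pairProd_eq_prod_image he (fun x y => (inner ℝ (f x) (f y) : ℝ))
      fun x y => real_inner_comm (f y) (f x)
    rw [pairProd] at this
    rw [this, pairingWeight]
    congr!
  -- The first equation at x is invariance under γτ at x, and the second is invariance at τ x; one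
  -- endpoint of each pair thus accounts for both.
  have hiff : ∀ i : AnnulusPoint n → Fin N,
      (∀ x ∈ Finset.univ.filter (fun x => e x < e (τ x)),
        i x = i (annulusRotation n (τ x)) ∧ i (annulusRotation n x) = i (τ x))
      ↔ ∀ x, i x = i ((annulusRotation n * τ) x) := by
    intro i
    constructor
    · intro h x
      rcases lt_trichotomy (e x) (e (τ x)) with hlt | heq | hgt
      · exact (h x (by simpa using hlt)).1
      · exact absurd (he heq).symm (hτ x).1
      · have := (h (τ x) (by simpa [(hτ x).2] using hgt)).2
        rw [(hτ x).2] at this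
        exact this.symm
    · intro h x _
      refine ⟨h x, ?_⟩
      have := h (τ x)
      rw [Equiv.Perm.mul_apply, (hτ x).2] at this
      exact this.symm
  simp_rw [pairProd, Finset.prod_ite_zero, hiff]
  rw [← Finset.sum_filter, Finset.sum_const, Finset.prod_mul_distrib, Finset.prod_const, hcard,
    ← Complex.ofReal_prod, hw, ← Fintype.card_subtype, ← Nat.card_eq_fintype_card,
    card_invariant_functions, Nat.card_fin, nsmul_eq_mul, Nat.cast_pow]
  ring

open Classical in
/-- The genus expansion of the cumulants of traces of products of Gaussian matrices. -/
theorem IsHermitianGaussianFamily.jointCumulant_traceProduct [IsProbabilityMeasure P]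
    (hX : IsHermitianGaussianFamily P X) (hr : 1 ≤ r) (hn : ∀ i, 1 ≤ n i)
    (f : AnnulusPoint n → H) :
    jointCumulant P (fun i => traceProduct X (fun k => f ⟨i, k⟩))
      = ∑ τ ∈ (pairings (AnnulusPoint n)).filter
          (fun τ => numOrbits (annulusRotation n) τ = 1),
        (N : ℂ)⁻¹ ^ numCycles τ * (N : ℂ) ^ numCycles (annulusRotation n * τ) *
          (pairingWeight f τ : ℂ) := by
  have : Nonempty (Fin r) := ⟨⟨0, hr⟩⟩
  obtain ⟨e, he⟩ : ∃ e : AnnulusPoint n → ℕ, Function.Injective e :=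
    ⟨fun x => (Fintype.equivFin (AnnulusPoint n) x : ℕ),
      Fin.val_injective.comp (Fintype.equivFin (AnnulusPoint n)).injective⟩
  have hprocess : ∀ (α : Type) (φ : α → H × Fin N × Fin N),
      IsGaussianProcess (fun a ω => X (φ a).1 ω (φ a).2.1 (φ a).2.2) P :=
    fun α φ => hX.isGaussian.comp_right φ
  -- It remains to show that the colouring sum is polynomial in m, with τ contributing in degree
  -- `numOrbits (annulusRotation n) τ`.
  refine sum_finpartition_cumulant_eq
    (fun B => ∫ ω, ∏ i ∈ B, traceProduct X (fun k => f ⟨i, k⟩) ω ∂P) (by simp) _ _ _ fun m => ?_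
  simp_rw [traceProduct_eq_sum (hn _)]
  have hstep : ∀ g : Fin r → Fin m,
      ∏ j, ∫ ω, ∏ l with g l = j, ∑ b : Fin (n l) → Fin N,
        ∏ k, X (f ⟨l, k⟩) ω (b k) (b (finRotate (n l) k)) ∂P
      = ∑ i : AnnulusPoint n → Fin N,
        ∑ τ ∈ (pairings (AnnulusPoint n)).filter (fun τ => ∀ x, g (τ x).1 = g x.1),
          pairProd e (fun x y =>
            if i x = i (annulusRotation n y) ∧ i (annulusRotation n x) = i y
            then (N : ℂ)⁻¹ * ((inner ℝ (f x) (f y) : ℝ) : ℂ) else 0) τ := by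
    intro g
    rw [prod_integral_prod_sum g
      (fun l (b : Fin (n l) → Fin N) ω => ∏ k, X (f ⟨l, k⟩) ω (b k) (b (finRotate (n l) k)))]
    swap
    · intro S i
      have := hX.isGaussian.integrable_prod (S.sigma fun l => (Finset.univ : Finset (Fin (n l))))
        fun x => (f x, i x.1 x.2, i x.1 (finRotate _ x.2))
      simpa only [Finset.prod_sigma] using this
    refine Fintype.sum_equiv (Equiv.piCurry fun (l : Fin r) (_ : Fin (n l)) => Fin N).symm _ _
      fun i => ?_
    set i' := (Equiv.piCurry fun (l : Fin r) (_ : Fin (n l)) => Fin N).symm i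
    rw [← prod_sum_pairings_fiber (fun x : AnnulusPoint n => g x.1)]
    refine Finset.prod_congr rfl fun j _ => ?_
    have h1 : ∀ ω, ∏ l with g l = j, ∏ k, X (f ⟨l, k⟩) ω (i l k) (i l (finRotate (n l) k))
        = ∏ x : {x : AnnulusPoint n // g x.1 = j},
          X (f x) ω (i' x) (i' (annulusRotation n x)) := by
      intro ω
      rw [← Finset.prod_subtype (Finset.univ.filter fun x : AnnulusPoint n => g x.1 = j) (by simp)
        fun x => X (f x) ω (i' x) (i' (annulusRotation n x))]
      have h2 : (Finset.univ.filter fun x : AnnulusPoint n => g x.1 = j)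
          = (Finset.univ.filter fun l => g l = j).sigma fun l => Finset.univ := by
        ext x; simp
      rw [h2, Finset.prod_sigma]
      rfl
    simp_rw [h1]
    rw [integral_prod_eq_sum_pairings
      (hprocess _ fun x : {x : AnnulusPoint n // g x.1 = j} =>
        (f x, i' x, i' (annulusRotation n x)))
      (fun x => hX.centered _ _ _) (he.comp Subtype.val_injective)]
    simp_rw [hX.integral_mul]
    rfl
  simp_rw [hstep, Finset.sum_filter]
  -- With τ outermost, the summand no longer depends on g, and the colourings compatible with τ are
  -- merely counted.
  rw [Finset.sum_comm]
  simp_rw [Finset.sum_comm (t := pairings (AnnulusPoint n))]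
  refine Finset.sum_congr rfl fun τ hτ => ?_
  simp_rw [← Finset.sum_filter, Finset.sum_const, nsmul_eq_mul]
  rw [← Finset.mul_sum, sum_pairProd_contraction he f (mem_pairings.1 hτ), ← Fintype.card_subtype,
    ← Nat.card_eq_fintype_card, card_invariant_circle_functions hn, Nat.card_fin, Nat.cast_pow,
    mul_comm]

end GaussianMatrices

/-! ### Planarity and the power of N -/

section Asymptotics

variable {r : ℕ} {n : Fin r → ℕ}

lemma isNonCrossingPerm_iff (hr : 1 ≤ r) (hn : ∀ i, 1 ≤ n i)
    {τ : Equiv.Perm (AnnulusPoint n)} (hτ : IsPairing τ) :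
    IsNonCrossingPerm n τ ↔ numOrbits (annulusRotation n) τ = 1 ∧
      numCycles (annulusRotation n * τ) + r = numCycles τ + 2 := by
  have : Nonempty (AnnulusPoint n) := ⟨⟨⟨0, hr⟩, ⟨0, hn _⟩⟩⟩
  have h := hτ.two_mul_numCycles
  rw [Nat.card_eq_fintype_card, Fintype.card_sigma] at h
  simp only [Fintype.card_fin] at h
  rw [IsNonCrossingPerm, ← numOrbits_eq_one_iff, hτ.inv_eq]
  refine and_congr_right fun _ => ?_
  omega

/-- The genus inequality bounds the left side by #(τ) + 2, equality means planarity, and parity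
excludes #(τ) + 1. -/
lemma numCycles_add_le_of_not_isNonCrossingPerm (hr : 1 ≤ r) (hn : ∀ i, 1 ≤ n i)
    {τ : Equiv.Perm (AnnulusPoint n)} (hτ : IsPairing τ)
    (hconn : numOrbits (annulusRotation n) τ = 1) (hnc : ¬ IsNonCrossingPerm n τ) :
    numCycles (annulusRotation n * τ) + r ≤ numCycles τ := by
  rw [isNonCrossingPerm_iff hr hn hτ, not_and] at hnc
  have h1 := hnc hconn
  have h2 := hτ.two_mul_numCycles
  obtain ⟨h3, h4⟩ := numCycles_add_numCycles_add_numCycles_mul (annulusRotation n) τ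
  rw [numCycles_annulusRotation hn] at h3 h4
  rw [hconn] at h3
  obtain ⟨c, hc⟩ := h4
  omega

end Asymptotics

theorem mainTheorem4
    {H : Type*} [NormedAddCommGroup H] [InnerProductSpace ℝ H] [CompleteSpace H]
    {Ω : ℕ → Type*} [∀ N, MeasurableSpace (Ω N)]
    (P : ∀ N, Measure (Ω N)) [∀ N, IsProbabilityMeasure (P N)]
    (X : ∀ N, H → Ω N → Matrix (Fin N) (Fin N) ℂ)
    (hX : ∀ N, 1 ≤ N → IsHermitianGaussianFamily (P N) (X N))
    (r : ℕ) (hr : 1 ≤ r) (n : Fin r → ℕ) (hn : ∀ i, 1 ≤ n i)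
    (f : AnnulusPoint n → H) :
    (∀ N, 1 ≤ N → ∀ B : Finset (Fin r),
      Integrable (fun ω => ∏ i ∈ B, traceProduct (X N) (fun k => f ⟨i, k⟩) ω) (P N)) ∧
    (fun N : ℕ =>
        jointCumulant (P N) (fun i => traceProduct (X N) (fun k => f ⟨i, k⟩)) -
          (N : ℂ) ^ (2 - (r : ℤ)) *
            ((∑ π ∈ nonCrossingPairings n, pairingWeight f π : ℝ) : ℂ))
      =O[atTop] (fun N : ℕ => (N : ℝ) ^ (-(r : ℤ))) := by
  classical
  refine ⟨fun N hN B => (hX N hN).integrable_prod_traceProduct hn f B, ?_⟩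
  set S := (pairings (AnnulusPoint n)).filter
    (fun τ => numOrbits (annulusRotation n) τ = 1) with hS
  have hNC : nonCrossingPairings n = S.filter fun τ => IsNonCrossingPerm n τ := by
    ext τ
    simp only [nonCrossingPairings, hS, Finset.mem_filter, Finset.mem_univ, true_and, mem_pairings]
    constructor
    · rintro ⟨h1, h2⟩
      exact ⟨⟨h1, ((isNonCrossingPerm_iff hr hn h1).1 h2).1⟩, h2⟩
    · rintro ⟨⟨h1, -⟩, h2⟩
      exact ⟨h1, h2⟩
  -- The planar terms cancel exactly; each remaining connected pairing carries a power of N at most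
  -- -r, so the constant is the sum of the absolute weights.
  refine IsBigO.of_bound (∑ τ ∈ S.filter fun τ => ¬ IsNonCrossingPerm n τ, |pairingWeight f τ|) ?_
  filter_upwards [eventually_ge_atTop 1] with N hN
  have hN0 : (N : ℂ) ≠ 0 := by exact_mod_cast (by omega : N ≠ 0)
  have hpow : ∀ τ : Equiv.Perm (AnnulusPoint n),
      (N : ℂ)⁻¹ ^ numCycles τ * (N : ℂ) ^ numCycles (annulusRotation n * τ)
        = (N : ℂ) ^ ((numCycles (annulusRotation n * τ) : ℤ) - numCycles τ) := fun τ => by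
    rw [zpow_sub₀ hN0, zpow_natCast, zpow_natCast, inv_pow, div_eq_inv_mul]
  have hmain : ∑ τ ∈ S.filter (fun τ => IsNonCrossingPerm n τ),
      (N : ℂ) ^ ((numCycles (annulusRotation n * τ) : ℤ) - numCycles τ) * (pairingWeight f τ : ℂ)
      = (N : ℂ) ^ (2 - (r : ℤ)) *
            ((∑ π ∈ nonCrossingPairings n, pairingWeight f π : ℝ) : ℂ) := by
    rw [hNC, Complex.ofReal_sum, Finset.mul_sum]
    refine Finset.sum_congr rfl fun τ hτ => ?_
    obtain ⟨h1, h2⟩ := Finset.mem_filter.1 hτ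
    have h3 := mem_pairings.1 (Finset.mem_filter.1 h1).1
    have h4 := ((isNonCrossingPerm_iff hr hn h3).1 h2).2
    congr 2
    omega
  rw [(hX N hN).jointCumulant_traceProduct hr hn f]
  simp_rw [hpow]
  rw [← Finset.sum_filter_add_sum_filter_not S fun τ => IsNonCrossingPerm n τ, hmain,
    add_sub_cancel_left, Finset.sum_mul]
  refine (norm_sum_le _ _).trans (Finset.sum_le_sum fun τ hτ => ?_)
  obtain ⟨h1, h2⟩ := Finset.mem_filter.1 hτ
  obtain ⟨h3, h4⟩ := Finset.mem_filter.1 h1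
  have h5 := numCycles_add_le_of_not_isNonCrossingPerm hr hn (mem_pairings.1 h3) h4 h2
  rw [norm_mul, norm_zpow, Complex.norm_natCast, Complex.norm_real, Real.norm_eq_abs, norm_zpow,
    Real.norm_natCast, mul_comm]
  refine mul_le_mul_of_nonneg_left ?_ (abs_nonneg _)
  exact zpow_le_zpow_right₀ (by exact_mod_cast hN) (by omega)
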